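/- **Setting.** For a state (positive operator of trace one) $\rho$ on a finite-dimensional complex Hilbert space, let $H(\rho)=-\operatorname{Tr}(\rho\log\rho)$ be its von Neumann entropy. For a quantum channel $\Phi:\mathcal B(H_A)\to\mathcal B(H_B)$, let $H_{\min}(\Phi)=\min_\rho H(\Phi(\rho))$ be its minimum output entropy, the minimum over all states $\rho$ on $H_A$. Let $N\ge 3$ and $q=\frac1N\cdot\frac{2}{1+\sqrt{1-4/N^2}}\in(0,1)$. Put $[n]_q=q^{-(n-1)}\frac{1-q^{2n}}{1-q^2}$, $[n]_q!=[n]_q[n-1]_q\cdots[1]_q$, and $$C(q)=(1-q^2)^{-1/2}\Big(\prod_{s=1}^\infty\frac1{1-q^{2s}}\Big)^{3/2}.$$ Let $e_1,\dots,e_N$ be the standard basis of $\mathbb C^N$ and $T_1=\sum_i e_i\otimes e_i$. Let $p_k$ be the Jones–Wenzl projections on $(\mathbb C^N)^{\otimes k}$: $p_0=\iota$, $p_1=\iota$ and, for $k\ge2$, $$p_k=\iota\otimes p_{k-1}-\tfrac{[k-1]_q}{[k]_q}(\iota\otimes p_{k-1})(T_1T_1^*\otimes\iota)(\iota\otimes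 p_{k-1}).$$ Let $H_k=p_k((\mathbb C^N)^{\otimes k})$; this is the space of the $k$-th irreducible representation of the free orthogonal quantum group $O_N^+$. Let $(k,l,m)\in\mathbb N_0^3$ be admissible, i.e. $k=l+m-2r$ with an integer $0\le r\le\min\{l,m\}$. Let $T_r=\sum_{i:\{1,\dots,r\}\to\{1,\dots,N\}}e_{i(1)}\otimes\cdots\otimes e_{i(r)}\otimes e_{i(r)}\otimes\cdots\otimes e_{i(1)}$, and let $$A_k^{l,m}=(p_l\otimes p_m)(\iota_{l-r}\otimes T_r\otimes\iota_{m-r})p_k:H_k\to H_l\otimes H_m,\qquad \alpha_k^{l,m}=\|A_k^{l,m}\|^{-1}A_k^{l,m},$$ $$\theta_q(k,l,m)=\frac{[r]_q!\,[l-r]_q!\,[m-r]_q!\,[k+r+1]_q!}{[l]_q!\,[m]_q!\,[k]_q!}.$$ **Statement.** The map $\alpha_k^{l,m}$ is an isometry and $\operatorname{Tr}_{H_k}\big((A_k^{l,m})^*A_k^{l,m}\big)=\theta_q(k,l,m)$. The complementary quantum channels $$\Phi_k^{\overline l,m}:\mathcal B(H_k)\to\mathcal B(H_m),\quad\rho\mapsto(\operatorname{Tr}_{H_l}\otimes\iota)\big(\alpha_k^{l,m}\rho(\alpha_k^{l,m})^*\big),$$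 $$\Phi_k^{l,\overline m}:\mathcal B(H_k)\to\mathcal B(H_l),\quad\rho\mapsto(\iota\otimes\operatorname{Tr}_{H_m})\big(\alpha_k^{l,m}\rho(\alpha_k^{l,m})^*\big)$$ satisfy $$H_{\min}(\Phi_k^{\overline l,m}),\ H_{\min}(\Phi_k^{l,\overline m})\ \ge\ \log\Big(\frac{\theta_q(k,l,m)}{[k+1]_q}\Big)\ \ge\ -\Big(\frac{l+m-k}{2}\Big)\log q-2\log C(q).$$ -/

import Mathlib

open scoped TensorProduct

noncomputable section

namespace FreeOrthogonal

/-! ### States, entropy, partial traces and complementary channels -/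

section Channels

variable {A B C : Type*}
  [NormedAddCommGroup A] [InnerProductSpace ℂ A] [FiniteDimensional ℂ A]
  [NormedAddCommGroup B] [InnerProductSpace ℂ B] [FiniteDimensional ℂ B]
  [NormedAddCommGroup C] [InnerProductSpace ℂ C] [FiniteDimensional ℂ C]

/-- A state (density operator): a positive semidefinite operator of trace one. -/
def IsState (ρ : A →ₗ[ℂ] A) : Prop :=
  ρ.IsPositive ∧ LinearMap.trace ℂ A ρ = 1

open Classical in
/-- The von Neumann entropy `-Tr (ρ log ρ) = -∑ λᵢ log λᵢ` (natural logarithm), where the `λᵢ` are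
the eigenvalues of `ρ`, listed with multiplicity. It is meant for self-adjoint `ρ` only, and is
set to `0` on the other operators. -/
def vonNeumannEntropy (ρ : A →ₗ[ℂ] A) : ℝ :=
  if h : ρ.IsSymmetric then ∑ i, Real.negMulLog (h.eigenvalues rfl i) else 0

/-- The minimum output entropy of `Φ : 𝓑(A) → 𝓑(B)`, the minimum of the entropy of `Φ ρ` over all
states `ρ` on `A`. -/
def minOutputEntropy (Φ : (A →ₗ[ℂ] A) →ₗ[ℂ] (B →ₗ[ℂ] B)) : ℝ :=
  sInf {h : ℝ | ∃ ρ : A →ₗ[ℂ] A, IsState ρ ∧ h = vonNeumannEntropy (Φ ρ)}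

/-- The partial trace `Tr_B ⊗ ι : 𝓑(B ⊗ C) = 𝓑(B) ⊗ 𝓑(C) → 𝓑(C)`. -/
def traceLeft : ((B ⊗[ℂ] C) →ₗ[ℂ] (B ⊗[ℂ] C)) →ₗ[ℂ] (C →ₗ[ℂ] C) :=
  (TensorProduct.lid ℂ (C →ₗ[ℂ] C)).toLinearMap ∘ₗ
    (LinearMap.trace ℂ B).rTensor (C →ₗ[ℂ] C) ∘ₗ
      (homTensorHomEquiv ℂ B C B C).symm.toLinearMap

/-- The partial trace `ι ⊗ Tr_C : 𝓑(B ⊗ C) = 𝓑(B) ⊗ 𝓑(C) → 𝓑(B)`. -/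
def traceRight : ((B ⊗[ℂ] C) →ₗ[ℂ] (B ⊗[ℂ] C)) →ₗ[ℂ] (B →ₗ[ℂ] B) :=
  (TensorProduct.rid ℂ (B →ₗ[ℂ] B)).toLinearMap ∘ₗ
    (LinearMap.trace ℂ C).lTensor (B →ₗ[ℂ] B) ∘ₗ
      (homTensorHomEquiv ℂ B C B C).symm.toLinearMap

/-- The map `ρ ↦ α ρ α*` from `𝓑(A)` to `𝓑(B ⊗ C)`. -/
def conjMap (α : A →ₗ[ℂ] B ⊗[ℂ] C) :
    (A →ₗ[ℂ] A) →ₗ[ℂ] ((B ⊗[ℂ] C) →ₗ[ℂ] (B ⊗[ℂ] C)) :=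
  LinearMap.lcomp ℂ (B ⊗[ℂ] C) (LinearMap.adjoint α) ∘ₗ LinearMap.llcomp ℂ A A (B ⊗[ℂ] C) α

/-- The channel `ρ ↦ (Tr_B ⊗ ι)(α ρ α*)` from `𝓑(A)` to `𝓑(C)`. -/
def channelRight (α : A →ₗ[ℂ] B ⊗[ℂ] C) : (A →ₗ[ℂ] A) →ₗ[ℂ] (C →ₗ[ℂ] C) :=
  traceLeft ∘ₗ conjMap α

/-- The channel `ρ ↦ (ι ⊗ Tr_C)(α ρ α*)` from `𝓑(A)` to `𝓑(B)`. -/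
def channelLeft (α : A →ₗ[ℂ] B ⊗[ℂ] C) : (A →ₗ[ℂ] A) →ₗ[ℂ] (B →ₗ[ℂ] B) :=
  traceRight ∘ₗ conjMap α

end Channels

/-! ### Quantum numbers -/

/-- The parameter `q = q(N) = (1/N) · 2 / (1 + √(1 - 4/N²))`. -/
def qParam (N : ℕ) : ℝ := 1 / (N : ℝ) * (2 / (1 + Real.sqrt (1 - 4 / (N : ℝ) ^ 2)))

/-- The quantum integer `[n]_q = q^{-(n-1)} (1 - q^{2n}) / (1 - q²)` (for `0 < q < 1`). -/
def qInt (q : ℝ) (n : ℕ) : ℝ := q ^ (1 - (n : ℤ)) * ((1 - q ^ (2 * n)) / (1 - q ^ 2))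

/-- The quantum factorial `[n]_q! = [n]_q [n-1]_q ⋯ [1]_q`. -/
def qFactorial (q : ℝ) (n : ℕ) : ℝ := ∏ i ∈ Finset.range n, qInt q (i + 1)

/-- `(k, l, m)` is admissible if `k = l + m - 2r` for some integer `0 ≤ r ≤ min l m`. -/
def Admissible (k l m : ℕ) : Prop := ∃ r : ℕ, r ≤ min l m ∧ k + 2 * r = l + m

/-- The number `r` with `k = l + m - 2r`, for an admissible triple. -/
def rank (k l m : ℕ) : ℕ := (l + m - k) / 2

/-- The `θ`-net
`θ_q(k,l,m) = [r]! [l-r]! [m-r]! [k+r+1]! / ([l]! [m]! [k]!)`, where `k = l + m - 2r`. -/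
def theta (q : ℝ) (k l m : ℕ) : ℝ :=
  qFactorial q (rank k l m) * qFactorial q (l - rank k l m) * qFactorial q (m - rank k l m) *
      qFactorial q (k + rank k l m + 1) /
    (qFactorial q l * qFactorial q m * qFactorial q k)

/-- `C(q) = (1 - q²)^{-1/2} (∏_{s ≥ 1} 1 / (1 - q^{2s}))^{3/2}`. -/
def constC (q : ℝ) : ℝ :=
  (1 - q ^ 2) ^ (-(1 / 2) : ℝ) * (∏' s : ℕ, 1 / (1 - q ^ (2 * (s + 1)))) ^ (3 / 2 : ℝ)

/-! ### Highest weight spaces and three-vertices -/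

/-- Indices of the standard basis `e_{i(1)} ⊗ ⋯ ⊗ e_{i(k)}` of `(ℂ^N)^{⊗ k}`. -/
abbrev Word (N k : ℕ) : Type := Fin k → Fin N

/-- `(ℂ^N)^{⊗ k}`, with the `e_{i(1)} ⊗ ⋯ ⊗ e_{i(k)}` as its standard orthonormal basis. -/
abbrev TPow (N k : ℕ) : Type := EuclideanSpace ℂ (Word N k)

/-- The matrix of `ι ⊗ X` on `ℂ^N ⊗ (ℂ^N)^{⊗ k}`, for `X` acting on `(ℂ^N)^{⊗ k}`. -/
def idTensor {N k : ℕ} (X : Matrix (Word N k) (Word N k) ℂ) :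
    Matrix (Word N (k + 1)) (Word N (k + 1)) ℂ :=
  Matrix.of fun i j => if i 0 = j 0 then X (Fin.tail i) (Fin.tail j) else 0

/-- The matrix of `T₁ T₁* ⊗ ι` on `(ℂ^N)^{⊗ 2} ⊗ (ℂ^N)^{⊗ k}`, where `T₁ = ∑ i, eᵢ ⊗ eᵢ`. -/
def cupCap (N k : ℕ) : Matrix (Word N (k + 2)) (Word N (k + 2)) ℂ :=
  Matrix.of fun i j =>
    if i 0 = i 1 ∧ j 0 = j 1 ∧ Fin.tail (Fin.tail i) = Fin.tail (Fin.tail j) then 1 else 0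

/-- The Jones-Wenzl projection `p_k` on `(ℂ^N)^{⊗ k}`, by the Wenzl recursion
`p_k = ι ⊗ p_{k-1} - ([k-1]_q / [k]_q) (ι ⊗ p_{k-1}) (T₁ T₁* ⊗ ι) (ι ⊗ p_{k-1})`. -/
def jonesWenzl (N : ℕ) : (k : ℕ) → Matrix (Word N k) (Word N k) ℂ
  | 0 => 1
  | 1 => 1
  | k + 2 =>
    idTensor (jonesWenzl N (k + 1)) -
      ((qInt (qParam N) (k + 1) / qInt (qParam N) (k + 2) : ℝ) : ℂ) •
        (idTensor (jonesWenzl N (k + 1)) * cupCap N k * idTensor (jonesWenzl N (k + 1)))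

/-- The Jones-Wenzl projection as an operator on `(ℂ^N)^{⊗ k}`. -/
def jwProj (N k : ℕ) : TPow N k →ₗ[ℂ] TPow N k := Matrix.toEuclideanLin (jonesWenzl N k)

/-- The highest weight space `H_k = p_k((ℂ^N)^{⊗ k})`, the space of the `k`-th irreducible
representation of `O_N⁺`, with the inner product of `(ℂ^N)^{⊗ k}`. -/
def H (N k : ℕ) : Type := ↥(LinearMap.range (jwProj N k))

instance (N k : ℕ) : NormedAddCommGroup (H N k) :=
  inferInstanceAs (NormedAddCommGroup ↥(LinearMap.range (jwProj N k)))

instance (N k : ℕ) : InnerProductSpace ℂ (H N k) :=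
  inferInstanceAs (InnerProductSpace ℂ ↥(LinearMap.range (jwProj N k)))

instance (N k : ℕ) : FiniteDimensional ℂ (H N k) :=
  inferInstanceAs (FiniteDimensional ℂ ↥(LinearMap.range (jwProj N k)))

/-- The inclusion of `H_k` into `(ℂ^N)^{⊗ k}`. -/
def incl (N k : ℕ) : H N k →ₗ[ℂ] TPow N k := (LinearMap.range (jwProj N k)).subtype

/-- The projection `p_k` as a map from `(ℂ^N)^{⊗ k}` onto `H_k`. -/
def proj (N k : ℕ) : TPow N k →ₗ[ℂ] H N k := (jwProj N k).rangeRestrict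

/-- For words `c`, `x`, `y`: whether `e_x ⊗ e_y` occurs in `(ι ⊗ T_r ⊗ ι) e_c`, where
`T_r = ∑ i, e_i ⊗ e_ǐ` and `ǐ` is `i` reversed. So `c = a b`, `x = a i` and `y = ǐ b` with
a word `i` of length `r`. -/
def Insertion {N k l m : ℕ} (r : ℕ) (c : Word N k) (x : Word N l) (y : Word N m) : Prop :=
  List.ofFn c = (List.ofFn x).take (l - r) ++ (List.ofFn y).drop r ∧
    (List.ofFn x).drop (l - r) = ((List.ofFn y).take r).reverse

open Classical in
/-- The map `ι_{l-r} ⊗ T_r ⊗ ι_{m-r} : (ℂ^N)^{⊗ k} → (ℂ^N)^{⊗ l} ⊗ (ℂ^N)^{⊗ m}`, where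
`k = l + m - 2r`; it sends `e_c` to the sum of the `e_x ⊗ e_y` with `Insertion r c x y`. -/
def insertCups (N k l m : ℕ) : TPow N k →ₗ[ℂ] TPow N l ⊗[ℂ] TPow N m :=
  (EuclideanSpace.basisFun (Word N k) ℂ).toBasis.constr ℂ fun c =>
    ∑ x : Word N l, ∑ y : Word N m,
      if Insertion (rank k l m) c x y then
        EuclideanSpace.single x (1 : ℂ) ⊗ₜ[ℂ] EuclideanSpace.single y (1 : ℂ)
      else 0

/-- The three-vertex `A_k^{l,m} = (p_l ⊗ p_m) (ι ⊗ T_r ⊗ ι) p_k`, from `H_k` to `H_l ⊗ H_m`. -/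
def threeVertex (N k l m : ℕ) : H N k →ₗ[ℂ] H N l ⊗[ℂ] H N m :=
  TensorProduct.map (proj N l) (proj N m) ∘ₗ insertCups N k l m ∘ₗ jwProj N k ∘ₗ incl N k

/-- The equivariant isometry `α_k^{l,m} = ‖A_k^{l,m}‖⁻¹ A_k^{l,m}` (operator norm). -/
def alpha (N k l m : ℕ) : H N k →ₗ[ℂ] H N l ⊗[ℂ] H N m :=
  ((‖LinearMap.toContinuousLinearMap (threeVertex N k l m)‖⁻¹ : ℝ) : ℂ) • threeVertex N k l m

/-- The channel `Φ_k^{l̄,m} : 𝓑(H_k) → 𝓑(H_m)`, `ρ ↦ (Tr ⊗ ι)(α ρ α*)`. -/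
def channelToM (N k l m : ℕ) : (H N k →ₗ[ℂ] H N k) →ₗ[ℂ] (H N m →ₗ[ℂ] H N m) :=
  channelRight (alpha N k l m)

/-- The channel `Φ_k^{l,m̄} : 𝓑(H_k) → 𝓑(H_l)`, `ρ ↦ (ι ⊗ Tr)(α ρ α*)`. -/
def channelToL (N k l m : ℕ) : (H N k →ₗ[ℂ] H N k) →ₗ[ℂ] (H N l →ₗ[ℂ] H N l) :=
  channelLeft (alpha N k l m)

end FreeOrthogonal

end

/-! Write t = θ/[k+1], l = a + r, m = b + r, k = a + b. Two facts carry the theorem: `threeVertex`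
multiplies all norms by √t, and contracting a vector of H_l or H_m against `threeVertex` ξ does not
increase norms. The first is proved without representation theory. The range of p_n consists of the
functions on words that every contraction of adjacent letters annihilates (`killed_kernel`,
`sum_kernel_mul`). On H_l ⊗ H_m, for a cup T, the Wenzl recursion gives T*(p_{l+1} ⊗ p_{m+1})T = N -
c_l - c_m + c_l c_m (p_l ⊗ p_m) T T* (`cap_pairProj_cup`). Starting from a vector of H_{a+b}, which
has no contraction between its two halves, each further cup therefore multiplies the squared norm by
a scalar (`cap_vertexVec_succ`, `sum_star_mul_vertexVec`). A quantum number identity evaluates it as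
`thetaFactor`, and the product of these factors is t (`capCoeff_wenzlRatio`, `theta_div_qInt`). The
trace formula follows, because dim H_k = [k+1]. For the second, the projections p_l and p_m can be
dropped, and what remains is a product of two matrices, whose Hilbert–Schmidt norm is
submultiplicative (`sum_norm_contract_right_le`, `sum_norm_contract_left_le`). After normalization,
every output state has all its eigenvalues at most 1/t, so its entropy is at least log t
(`neg_log_le_vonNeumannEntropy`). The last inequality bounds each factor of t below by q⁻¹(1 -
q^{2i})² for i = 1, …, r (`le_thetaFactor`, `log_theta_ge`). Words are handled as lists, so that
they can be split, joined and reversed without casts between index types. -/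

noncomputable section

namespace FreeOrthogonal

/-! ### Words, adjacent contractions and Jones–Wenzl projections -/

section Lists

variable {α : Type*} [Fintype α]

/-- The finite set of all words of length `n`. -/
def words (α : Type*) [Fintype α] (n : ℕ) : Finset (List α) :=
  Finset.univ.map ⟨fun w : Fin n → α => List.ofFn w, List.ofFn_injective⟩

lemma sum_words {M : Type*} [AddCommMonoid M] (n : ℕ) (f : List α → M) :
    ∑ x ∈ words α n, f x = ∑ w : Fin n → α, f (List.ofFn w) := by
  simp [words]

lemma mem_words {n : ℕ} {x : List α} : x ∈ words α n ↔ x.length = n := by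
  simp only [words, Finset.mem_map, Finset.mem_univ, true_and, Function.Embedding.coeFn_mk]
  constructor
  · rintro ⟨w, rfl⟩
    simp
  · rintro rfl
    exact ⟨x.get, List.ofFn_get x⟩

lemma cons_mem_words {n : ℕ} {i : α} {x : List α} : i :: x ∈ words α (n + 1) ↔ x ∈ words α n := by
  simp [mem_words]

lemma words_zero : words α 0 = {[]} := by
  ext x
  simp [mem_words]

lemma sum_words_succ {M : Type*} [AddCommMonoid M] (n : ℕ) (f : List α → M) :
    ∑ x ∈ words α (n + 1), f x = ∑ i, ∑ x ∈ words α n, f (i :: x) := by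
  simp only [sum_words, ← Finset.sum_product', Finset.univ_product_univ]
  refine (Fintype.sum_equiv (Fin.consEquiv fun _ => α) _ _ ?_).symm
  rintro ⟨i, w⟩
  simp [Fin.consEquiv, List.ofFn_succ]

lemma exists_cons_of_mem {n : ℕ} {x : List α} (hx : x ∈ words α (n + 1)) :
    ∃ i, ∃ y ∈ words α n, x = i :: y := by
  cases x with
  | nil => simp [mem_words] at hx
  | cons i y => exact ⟨i, y, cons_mem_words.1 hx, rfl⟩

lemma sum_words_add {M : Type*} [AddCommMonoid M] (m n : ℕ) (f : List α → M) :
    ∑ x ∈ words α (m + n), f x = ∑ u ∈ words α m, ∑ v ∈ words α n, f (u ++ v) := by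
  induction m generalizing f with
  | zero => simp [words_zero]
  | succ m ih => simp [Nat.succ_add m n, sum_words_succ, ih]

lemma sum_words_reverse {M : Type*} [AddCommMonoid M] (n : ℕ) (f : List α → M) :
    ∑ x ∈ words α n, f x.reverse = ∑ x ∈ words α n, f x := by
  refine Finset.sum_nbij' List.reverse List.reverse ?_ ?_ ?_ ?_ ?_ <;> simp [mem_words]

/-- `f` is annihilated, on words of length `n`, by all contractions of adjacent letters. -/
def Killed (n : ℕ) (f : List α → ℂ) : Prop :=
  ∀ x y : List α, x.length + y.length + 2 = n → ∑ s, f (x ++ s :: s :: y) = 0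

lemma killed_succ {n : ℕ} {f : List α → ℂ} :
    Killed (n + 1) f ↔ (∀ i, Killed n fun x => f (i :: x)) ∧
      ∀ t : List α, t.length + 1 = n → ∑ s, f (s :: s :: t) = 0 := by
  constructor
  · intro h
    refine ⟨fun i x y hxy => h (i :: x) y (by simp; omega), fun t ht => h [] t (by simp; omega)⟩
  · rintro ⟨h1, h2⟩ x y hxy
    cases x with
    | nil => exact h2 y (by simp at hxy; omega)
    | cons i x => exact h1 i x y (by simp at hxy; omega)

lemma Killed.reverse {n : ℕ} {f : List α → ℂ} (h : Killed n f) : Killed n fun x => f x.reverse := by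
  intro x y hxy
  simpa using h y.reverse x.reverse (by simp; omega)

lemma Killed.sum {n : ℕ} {ι : Type*} (s : Finset ι) (a : ι → ℂ) (f : ι → List α → ℂ)
    (h : ∀ i ∈ s, Killed n (f i)) : Killed n fun x => ∑ i ∈ s, f i x * a i := by
  intro x y hxy
  rw [Finset.sum_comm]
  refine Finset.sum_eq_zero fun i hi => ?_
  rw [← Finset.sum_mul, h i hi x y hxy, zero_mul]

variable [DecidableEq α]

/-- The matrix coefficients of the Jones-Wenzl projections, with `c n` in the place of
`[n] / [n + 1]`. -/
def kernel (c : ℕ → ℂ) : ℕ → List α → List α → ℂ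
  | 0, _, _ => 1
  | n + 1, i :: x, j :: y => (if i = j then kernel c n x y else 0) -
      c n * ∑ t ∈ words α (n - 1), kernel c n x (i :: t) * kernel c n (j :: t) y
  | _ + 1, _, _ => 0

/-- The coefficients `c n = [n] / [n + 1]` at the value `N = card α` of a loop. -/
structure WenzlCoeff (α : Type*) [Fintype α] (c : ℕ → ℂ) : Prop where
  real : ∀ n, star (c n) = c n
  zero : c 0 = 0
  succ : ∀ n, c (n + 1) * (Fintype.card α - c n) = 1

variable {c : ℕ → ℂ}

lemma kernel_cons (n : ℕ) (i j : α) (x y : List α) :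
    kernel c (n + 1) (i :: x) (j :: y) = (if i = j then kernel c n x y else 0) -
      c n * ∑ t ∈ words α (n - 1), kernel c n x (i :: t) * kernel c n (j :: t) y := rfl

lemma star_kernel (hc : WenzlCoeff α c) (n : ℕ) (x y : List α) :
    star (kernel c n x y) = kernel c n y x := by
  induction n generalizing x y with
  | zero => simp [kernel]
  | succ n ih =>
    cases x with
    | nil => cases y <;> simp [kernel]
    | cons i x =>
      cases y with
      | nil => simp [kernel]
      | cons j y =>
        rw [kernel_cons, kernel_cons, star_sub, star_mul', hc.real, star_sum]
        congr 1
        · by_cases h : i = j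
          · simp only [h, if_true, ih]
          · simp [h, Ne.symm h]
        · congr 1
          refine Finset.sum_congr rfl fun t _ => ?_
          rw [star_mul', ih, ih, mul_comm]

/-- In the Wenzl recursion ι ⊗ p_n fixes f by induction, and the correction term then contains the
contraction T₁* f, which is zero. Every later absorption property of the projections is derived from
this lemma. -/
lemma sum_kernel_mul (hc : WenzlCoeff α c) {n : ℕ} {f : List α → ℂ} (hf : Killed n f)
    {x : List α} (hx : x ∈ words α n) : ∑ y ∈ words α n, kernel c n x y * f y = f x := by
  induction n generalizing f x with
  | zero =>
    obtain rfl : x = [] := by simpa [words_zero] using hx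
    simp [words_zero, kernel]
  | succ n ih =>
    obtain ⟨i, x, hx', rfl⟩ := exists_cons_of_mem hx
    obtain ⟨h1, h2⟩ := killed_succ.1 hf
    have key : ∑ j, ∑ y ∈ words α n, (c n * ∑ t ∈ words α (n - 1),
        kernel c n x (i :: t) * kernel c n (j :: t) y) * f (j :: y) = 0 := by
      cases n with
      | zero => simp [hc.zero]
      | succ n =>
        simp only [mul_assoc, Finset.sum_mul, ← Finset.mul_sum]
        rw [mul_eq_zero]
        right
        have : ∀ j, ∑ y ∈ words α (n + 1), ∑ t ∈ words α (n + 1 - 1),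
            kernel c (n + 1) x (i :: t) * (kernel c (n + 1) (j :: t) y * f (j :: y)) =
            ∑ t ∈ words α (n + 1 - 1), kernel c (n + 1) x (i :: t) * f (j :: j :: t) := by
          intro j
          rw [Finset.sum_comm]
          refine Finset.sum_congr rfl fun t ht => ?_
          rw [← Finset.mul_sum, ih (h1 j) (cons_mem_words.2 ht)]
        simp only [this]
        rw [Finset.sum_comm]
        refine Finset.sum_eq_zero fun t ht => ?_
        rw [← Finset.mul_sum, h2 t (by simpa [mem_words] using ht), mul_zero]
    simp only [sum_words_succ, kernel_cons, sub_mul, Finset.sum_sub_distrib, key, ite_mul, zero_mul,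
      sub_zero]
    rw [Finset.sum_eq_single i]
    · simpa using ih (h1 i) hx'
    · intro j _ hj
      simp [Ne.symm hj]
    · simp

lemma sum_kernel_mul_kernel (hc : WenzlCoeff α c) {n : ℕ}
    (h : ∀ y : List α, Killed n fun x => kernel c n x y) {x : List α} (hx : x ∈ words α n)
    (z : List α) :
    ∑ y ∈ words α n, kernel c n x y * kernel c n y z = kernel c n x z :=
  sum_kernel_mul hc (h z) hx

/-- This is the partial trace of p_{n+1} over its first letter: the term ι ⊗ p_n contributes N p_n,
and the correction contributes c_n p_n² = c_n p_n. The hypothesis `h` is discharged in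
`killed_kernel`, whose induction needs this trace in lower degree. -/
lemma sum_kernel_cons_of_killed (hc : WenzlCoeff α c) {n : ℕ}
    (h : ∀ y : List α, Killed n fun x => kernel c n x y) {x y : List α} (hx : x ∈ words α n) :
    ∑ s, kernel c (n + 1) (s :: x) (s :: y) = (Fintype.card α - c n) * kernel c n x y := by
  simp only [kernel_cons, if_true, Finset.sum_sub_distrib, ← Finset.mul_sum]
  cases n with
  | zero => simp [hc.zero]
  | succ n =>
    rw [Nat.add_sub_cancel, ← sum_words_succ n fun z => kernel c (n + 1) x z * kernel c (n + 1) z y,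
      sum_kernel_mul_kernel hc h hx]
    simp
    ring

/-- Contractions away from the first letter are inherited from p_{n-1}. For the contraction of the
first two letters, the partial trace of the correction produces the scalar N - c_{n-2}, and c_{n-1}
is chosen so that the two terms of the recursion cancel. -/
lemma killed_kernel (hc : WenzlCoeff α c) (n : ℕ) (y : List α) :
    Killed n fun x => kernel c n x y := by
  induction n using Nat.strong_induction_on generalizing y with
  | _ n ih =>
  cases n with
  | zero => intro x y h; omega
  | succ n =>
  cases y with
  | nil => intro x y h; cases x <;> simp [kernel]
  | cons j y =>
  rw [killed_succ]
  constructor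
  · intro i x z hxz
    simp only [kernel_cons, Finset.sum_sub_distrib, ← Finset.mul_sum]
    rw [Finset.sum_comm]
    have h0 : ∀ w, ∑ s, kernel c n (x ++ s :: s :: z) w = 0 := fun w =>
      ih n (Nat.lt_succ_self n) w x z hxz
    simp only [← Finset.sum_mul, h0]
    by_cases hij : i = j <;> simp [hij, h0]
  · intro t ht
    obtain ⟨n, rfl⟩ : ∃ m, n = m + 1 := ⟨t.length, ht.symm⟩
    have ht' : t ∈ words α n := mem_words.2 (by omega)
    simp only [kernel_cons (n + 1), Finset.sum_sub_distrib, ← Finset.mul_sum]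
    rw [Finset.sum_comm]
    simp only [← Finset.sum_mul, sum_kernel_cons_of_killed hc (ih n (by omega)) ht', mul_assoc,
      ← Finset.mul_sum]
    -- The coefficient recursion turns the scalar into 1, and the remaining p_n is absorbed by
    -- p_{n+1}.
    rw [← mul_assoc, hc.succ, one_mul, Nat.add_sub_cancel,
      sum_kernel_mul hc ((killed_succ.1 (ih (n + 1) (by omega) y)).1 j) ht']
    simp

lemma sum_kernel_cons (hc : WenzlCoeff α c) {n : ℕ} {x y : List α} (hx : x ∈ words α n) :
    ∑ s, kernel c (n + 1) (s :: x) (s :: y) = (Fintype.card α - c n) * kernel c n x y :=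
  sum_kernel_cons_of_killed hc (killed_kernel hc n) hx

/-- The recursion treats the first letter specially, but its range condition is symmetric under
reversal. So p and its reversal p' are self-adjoint and fix the same vectors: p p' = p' and p' p =
p, and taking adjoints in the latter gives p = p'. -/
lemma kernel_reverse (hc : WenzlCoeff α c) {n : ℕ} {x y : List α} (hx : x ∈ words α n)
    (hy : y ∈ words α n) : kernel c n x.reverse y.reverse = kernel c n x y := by
  have h1 : ∑ z ∈ words α n, kernel c n x z * kernel c n z.reverse y.reverse =
      kernel c n x.reverse y.reverse :=
    sum_kernel_mul hc (killed_kernel hc n y.reverse).reverse hx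
  have h2 : ∑ z ∈ words α n, kernel c n y.reverse z * kernel c n z.reverse x =
      kernel c n y.reverse.reverse x :=
    sum_kernel_mul hc (killed_kernel hc n x).reverse (by simpa [mem_words] using hy)
  rw [← sum_words_reverse] at h2
  have h3 := congrArg star h2
  simp only [star_sum, star_mul', star_kernel hc, List.reverse_reverse] at h3
  rw [← h1, ← h3]
  exact Finset.sum_congr rfl fun z _ => mul_comm _ _

lemma sum_trace_kernel (hc : WenzlCoeff α c) (n : ℕ) :
    ∑ x ∈ words α (n + 1), kernel c (n + 1) x x =
      (Fintype.card α - c n) * ∑ x ∈ words α n, kernel c n x x := by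
  rw [sum_words_succ, Finset.sum_comm, Finset.mul_sum]
  exact Finset.sum_congr rfl fun x hx => sum_kernel_cons hc hx

/-- The projection `p_{n+1}` absorbs the projection `ι ⊗ p_n`. -/
lemma sum_kernel_succ_mul_kernel (hc : WenzlCoeff α c) {n : ℕ} (i : α) (z : List α) {x : List α}
    (hx : x ∈ words α n) :
    ∑ y ∈ words α n, kernel c (n + 1) z (i :: y) * kernel c n y x =
      kernel c (n + 1) z (i :: x) := by
  have h := congrArg star (sum_kernel_mul hc
    ((killed_succ.1 (killed_kernel hc (n + 1) z)).1 i) hx)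
  simp only [star_sum, star_mul', star_kernel hc] at h
  rw [← h]
  exact Finset.sum_congr rfl fun z _ => mul_comm _ _

end Lists

/-! ### Inserting cups into pairs of words -/

section Pairs

lemma sum_comm_pairs {ι κ ι' κ' M : Type*} [AddCommMonoid M] (s : Finset ι) (t : Finset κ)
    (s' : Finset ι') (t' : Finset κ') (f : ι → κ → ι' → κ' → M) :
    ∑ x ∈ s, ∑ y ∈ t, ∑ x' ∈ s', ∑ y' ∈ t', f x y x' y' =
      ∑ x' ∈ s', ∑ y' ∈ t', ∑ x ∈ s, ∑ y ∈ t, f x y x' y' := by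
  rw [← Finset.sum_product', Finset.sum_comm]
  refine Finset.sum_congr rfl fun x' _ => ?_
  rw [Finset.sum_comm]
  exact Finset.sum_congr rfl fun y' _ => Finset.sum_product' s t fun x y => f x y x' y'

variable {α : Type*} [DecidableEq α]

/-- Insertion of a cup at the front of both words. -/
def cup (F : List α → List α → ℂ) : List α → List α → ℂ
  | i :: x, j :: y => if i = j then F x y else 0
  | _, _ => 0

lemma iterate_cup (r : ℕ) (Z : List α → List α → ℂ) {x y : List α} (hx : r ≤ x.length)
    (hy : r ≤ y.length) :
    cup^[r] Z x y = if x.take r = y.take r then Z (x.drop r) (y.drop r) else 0 := by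
  induction r generalizing x y with
  | zero => simp
  | succ r ih =>
    rcases x with _ | ⟨i, x⟩
    · simp at hx
    rcases y with _ | ⟨j, y⟩
    · simp at hy
    rw [Function.iterate_succ_apply', cup, ih (by simpa using hx) (by simpa using hy)]
    by_cases h : i = j <;> simp [h]

variable [Fintype α] {c : ℕ → ℂ}

/-- The projection `p_l ⊗ p_m`, acting on functions of two words. -/
def pairProj (c : ℕ → ℂ) (l m : ℕ) (F : List α → List α → ℂ) (x y : List α) : ℂ :=
  ∑ x' ∈ words α l, kernel c l x x' * ∑ y' ∈ words α m, kernel c m y y' * F x' y'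

/-- Contraction of the first letters of two words. -/
def cap (F : List α → List α → ℂ) (x y : List α) : ℂ := ∑ s, F (s :: x) (s :: y)

/-- `F` is fixed by `p_l ⊗ p_m`. -/
structure BiKilled (l m : ℕ) (F : List α → List α → ℂ) : Prop where
  left : ∀ y ∈ words α m, Killed l fun x => F x y
  right : ∀ x ∈ words α l, Killed m fun y => F x y

lemma biKilled_pairProj (hc : WenzlCoeff α c) (l m : ℕ) (F : List α → List α → ℂ) :
    BiKilled l m (pairProj c l m F) where
  left y _ := Killed.sum _ _ _ fun x' _ => killed_kernel hc l x'
  right x _ := by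
    have : (fun y => pairProj c l m F x y) = fun y => ∑ y' ∈ words α m, kernel c m y y' *
        ∑ x' ∈ words α l, kernel c l x x' * F x' y' := by
      funext y
      simp only [pairProj, Finset.mul_sum]
      rw [Finset.sum_comm]
      exact Finset.sum_congr rfl fun _ _ => Finset.sum_congr rfl fun _ _ => by ring
    rw [this]
    exact Killed.sum _ _ _ fun y' _ => killed_kernel hc m y'

lemma pairProj_congr {l m : ℕ} {F G : List α → List α → ℂ}
    (h : ∀ x ∈ words α l, ∀ y ∈ words α m, F x y = G x y) (x y : List α) :
    pairProj c l m F x y = pairProj c l m G x y := by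
  refine Finset.sum_congr rfl fun x' hx => ?_
  congr 1
  exact Finset.sum_congr rfl fun y' hy => by rw [h x' hx y' hy]

lemma pairProj_smul (l m : ℕ) (a : ℂ) (F : List α → List α → ℂ) (x y : List α) :
    pairProj c l m (fun x y => a * F x y) x y = a * pairProj c l m F x y := by
  simp only [pairProj, Finset.mul_sum]
  exact Finset.sum_congr rfl fun _ _ => Finset.sum_congr rfl fun _ _ => by ring

lemma pairProj_of_biKilled (hc : WenzlCoeff α c) {l m : ℕ} {F : List α → List α → ℂ}
    (hF : BiKilled l m F) {x y : List α} (hx : x ∈ words α l) (hy : y ∈ words α m) :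
    pairProj c l m F x y = F x y := by
  have : pairProj c l m F x y = ∑ x' ∈ words α l, kernel c l x x' * F x' y :=
    Finset.sum_congr rfl fun x' hx' => by rw [sum_kernel_mul hc (hF.right x' hx') hy]
  rw [this, sum_kernel_mul hc (hF.left y hy) hx]

lemma pairProj_succ_cup (l m : ℕ) (F : List α → List α → ℂ) (x y : List α) :
    pairProj c (l + 1) (m + 1) (cup F) x y =
      ∑ i, ∑ x' ∈ words α l, kernel c (l + 1) x (i :: x') *
        ∑ y' ∈ words α m, kernel c (m + 1) y (i :: y') * F x' y' := by
  simp only [pairProj, sum_words_succ, cup, mul_ite, mul_zero]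
  refine Finset.sum_congr rfl fun i _ => Finset.sum_congr rfl fun x' _ => ?_
  congr 1
  rw [Finset.sum_eq_single i]
  · simp
  · intro j _ hj
    simp [Ne.symm hj]
  · simp

/-- `(p_{l+1} ⊗ p_{m+1}) T (p_l ⊗ p_m) = (p_{l+1} ⊗ p_{m+1}) T` for a cup `T`. -/
lemma pairProj_cup_pairProj (hc : WenzlCoeff α c) (l m : ℕ) (F : List α → List α → ℂ)
    (x y : List α) :
    pairProj c (l + 1) (m + 1) (cup (pairProj c l m F)) x y =
      pairProj c (l + 1) (m + 1) (cup F) x y := by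
  rw [pairProj_succ_cup, pairProj_succ_cup]
  refine Finset.sum_congr rfl fun i _ => ?_
  have h1 : ∀ x', ∑ y' ∈ words α m, kernel c (m + 1) y (i :: y') * pairProj c l m F x' y' =
      ∑ x'' ∈ words α l, kernel c l x' x'' *
        ∑ y'' ∈ words α m, kernel c (m + 1) y (i :: y'') * F x'' y'' := by
    intro x'
    simp only [pairProj, Finset.mul_sum]
    rw [Finset.sum_comm]
    refine Finset.sum_congr rfl fun x'' _ => ?_
    rw [Finset.sum_comm]
    refine Finset.sum_congr rfl fun y'' hy'' => ?_
    rw [← sum_kernel_succ_mul_kernel hc i y hy'', Finset.sum_mul, Finset.mul_sum]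
    exact Finset.sum_congr rfl fun _ _ => by ring
  simp only [h1]
  simp only [Finset.mul_sum (words α l)]
  rw [Finset.sum_comm]
  refine Finset.sum_congr rfl fun x'' hx'' => ?_
  rw [← sum_kernel_succ_mul_kernel hc i x hx'', Finset.sum_mul]
  exact Finset.sum_congr rfl fun _ _ => by ring

/-- One step of the recursion, applied to a vector that p_n fixes: both occurrences of p_n next to g
disappear. -/
lemma sum_kernel_succ_mul (hc : WenzlCoeff α c) {n : ℕ} {g : List α → ℂ} (hg : Killed n g)
    (s i : α) {x : List α} (hx : x ∈ words α n) :
    ∑ x' ∈ words α n, kernel c (n + 1) (s :: x) (i :: x') * g x' =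
      (if s = i then g x else 0) -
        c n * ∑ t ∈ words α (n - 1), kernel c n x (s :: t) * g (i :: t) := by
  simp only [kernel_cons, sub_mul, Finset.sum_sub_distrib]
  congr 1
  · by_cases h : s = i
    · simpa [h] using sum_kernel_mul hc hg hx
    · simp [h]
  · cases n with
    | zero => simp [hc.zero]
    | succ n =>
      simp only [mul_assoc, Finset.sum_mul, ← Finset.mul_sum]
      rw [Finset.sum_comm]
      congr 1
      refine Finset.sum_congr rfl fun t ht => ?_
      rw [← Finset.mul_sum, sum_kernel_mul hc hg (cons_mem_words.2 ht)]

/-- The factor c n is kept on both sides because for n = 0 the subtraction n - 1 truncates and the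
sums themselves differ; there c 0 = 0 makes the identity true. -/
lemma coeff_mul_sum_kernel (hc : WenzlCoeff α c) {n : ℕ} {g : List α → ℂ} (hg : Killed n g)
    {x : List α} (hx : x ∈ words α n) :
    c n * ∑ s, ∑ t ∈ words α (n - 1), kernel c n x (s :: t) * g (s :: t) = c n * g x := by
  cases n with
  | zero => simp [hc.zero]
  | succ n =>
    rw [Nat.add_sub_cancel, ← sum_words_succ n fun z => kernel c (n + 1) x z * g z,
      sum_kernel_mul hc hg hx]

/-- The expansion of `T* (p_{l+1} ⊗ p_{m+1}) T` on `H_l ⊗ H_m`, for a cup `T`. -/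
lemma cap_pairProj_cup (hc : WenzlCoeff α c) {l m : ℕ} {G : List α → List α → ℂ}
    (hG : BiKilled l m G) {x y : List α} (hx : x ∈ words α l) (hy : y ∈ words α m) :
    cap (pairProj c (l + 1) (m + 1) (cup G)) x y =
      (Fintype.card α - c l - c m) * G x y +
        c l * c m * pairProj c l m (cup (cap G)) x y := by
  have step : ∀ s, pairProj c (l + 1) (m + 1) (cup G) (s :: x) (s :: y) =
      G x y - c m * (∑ t' ∈ words α (m - 1), kernel c m y (s :: t') * G x (s :: t')) -
        c l * (∑ t ∈ words α (l - 1), kernel c l x (s :: t) * G (s :: t) y) +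
        c l * c m * ∑ t ∈ words α (l - 1), kernel c l x (s :: t) *
          ∑ t' ∈ words α (m - 1), kernel c m y (s :: t') * cap G t t' := by
    intro s
    rw [pairProj_succ_cup]
    set R : α → List α → ℂ := fun i x' => (if s = i then G x' y else 0) -
      c m * ∑ t' ∈ words α (m - 1), kernel c m y (s :: t') * G x' (i :: t') with hR
    -- R i is the result of expanding p_{m+1} on the second word. It is still fixed by p_l in the
    -- first word, so the same expansion applies there.
    have hRk : ∀ i, Killed l (R i) := by
      intro i u v huv
      simp only [hR, Finset.sum_sub_distrib, ← Finset.mul_sum]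
      rw [Finset.sum_comm]
      simp only [← Finset.mul_sum]
      have e1 : ∑ z, (if s = i then G (u ++ z :: z :: v) y else 0) = 0 := by
        by_cases h : s = i
        · simpa [h] using hG.left y hy u v huv
        · simp [h]
      rw [e1, zero_sub, neg_eq_zero, mul_eq_zero]
      -- For m = 0 the word i :: t' is too long for `hG`, and the vanishing comes from c 0 = 0.
      rcases m with _ | m
      · exact Or.inl hc.zero
      · refine Or.inr (Finset.sum_eq_zero fun t' ht' => ?_)
        rw [hG.left (i :: t') (cons_mem_words.2 ht') u v huv, mul_zero]
    have e2 : ∀ i, ∑ x' ∈ words α l, kernel c (l + 1) (s :: x) (i :: x') *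
        ∑ y' ∈ words α m, kernel c (m + 1) (s :: y) (i :: y') * G x' y' =
        (if s = i then R i x else 0) -
          c l * ∑ t ∈ words α (l - 1), kernel c l x (s :: t) * R i (i :: t) := by
      intro i
      rw [← sum_kernel_succ_mul hc (hRk i) s i hx]
      exact Finset.sum_congr rfl fun x' hx' => by
        rw [sum_kernel_succ_mul hc (hG.right x' hx') s i hy]
    simp only [e2, Finset.sum_sub_distrib, ← Finset.mul_sum]
    rw [Finset.sum_comm]
    simp only [← Finset.mul_sum]
    have e3 : ∀ t, ∑ i, R i (i :: t) = G (s :: t) y -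
        c m * ∑ t' ∈ words α (m - 1), kernel c m y (s :: t') * cap G t t' := by
      intro t
      simp only [hR, Finset.sum_sub_distrib, ← Finset.mul_sum, cap]
      rw [Finset.sum_comm]
      simp [Finset.mul_sum]
    simp only [e3, mul_sub, Finset.sum_sub_distrib]
    have e4 : ∑ t ∈ words α (l - 1), kernel c l x (s :: t) * (c m *
        ∑ t' ∈ words α (m - 1), kernel c m y (s :: t') * cap G t t') =
        c m * ∑ t ∈ words α (l - 1), kernel c l x (s :: t) *
          ∑ t' ∈ words α (m - 1), kernel c m y (s :: t') * cap G t t' := by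
      rw [Finset.mul_sum]
      exact Finset.sum_congr rfl fun _ _ => by ring
    rw [e4]
    simp only [Finset.sum_ite_eq, Finset.mem_univ, if_true, hR]
    ring
  have last : c l * c m * pairProj c l m (cup (cap G)) x y = c l * c m *
      ∑ s, ∑ t ∈ words α (l - 1), kernel c l x (s :: t) *
          ∑ t' ∈ words α (m - 1), kernel c m y (s :: t') * cap G t t' := by
    rcases l with _ | l
    · simp [hc.zero]
    rcases m with _ | m
    · simp [hc.zero]
    rw [pairProj_succ_cup]
    rfl
  rw [last, cap]
  simp only [step, Finset.sum_sub_distrib, Finset.sum_add_distrib, ← Finset.mul_sum,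
    coeff_mul_sum_kernel hc (hG.left y hy) hx, coeff_mul_sum_kernel hc (hG.right x hx) hy]
  simp
  ring

/-- The vectors `(p_{a+r} ⊗ p_{b+r}) T_r Z`, obtained by inserting one cup at a time. -/
def vertexVec (c : ℕ → ℂ) (a b : ℕ) (Z : List α → List α → ℂ) : ℕ → List α → List α → ℂ
  | 0 => Z
  | r + 1 => pairProj c (a + r + 1) (b + r + 1) (cup (vertexVec c a b Z r))

/-- The scalars by which one contraction acts on the vectors `(p_{a+r} ⊗ p_{b+r}) T_r Z`. -/
def capCoeff (c : ℕ → ℂ) (N : ℂ) (a b : ℕ) : ℕ → ℂ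
  | 0 => 0
  | r + 1 => N - c (a + r) - c (b + r) + c (a + r) * c (b + r) * capCoeff c N a b r

lemma vertexVec_succ (a b : ℕ) (Z : List α → List α → ℂ) (r : ℕ) :
    vertexVec c a b Z (r + 1) = pairProj c (a + r + 1) (b + r + 1) (cup (vertexVec c a b Z r)) :=
  rfl

lemma biKilled_vertexVec (hc : WenzlCoeff α c) {a b : ℕ} {Z : List α → List α → ℂ}
    (hZ : BiKilled a b Z) (r : ℕ) : BiKilled (a + r) (b + r) (vertexVec c a b Z r) := by
  cases r with
  | zero => exact hZ
  | succ r => exact biKilled_pairProj hc _ _ _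

/-- In `cap_pairProj_cup` the term T T* first lowers the vertex vector by one cup, at the cost of
the previous scalar, and then restores it. Hence the contraction acts by a scalar obeying the
recursion of `capCoeff`, which starts at 0 because Z itself has zero contraction. -/
lemma cap_vertexVec_succ (hc : WenzlCoeff α c) {a b : ℕ} {Z : List α → List α → ℂ}
    (hZ : BiKilled a b Z)
    (hZ' : ∀ x y : List α, x.length + 1 = a → y.length + 1 = b → cap Z x y = 0) (r : ℕ)
    {x y : List α} (hx : x ∈ words α (a + r)) (hy : y ∈ words α (b + r)) :
    cap (vertexVec c a b Z (r + 1)) x y =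
      capCoeff c (Fintype.card α) a b (r + 1) * vertexVec c a b Z r x y := by
  induction r generalizing x y with
  | zero =>
    rw [vertexVec_succ, cap_pairProj_cup hc (biKilled_vertexVec hc hZ 0) hx hy]
    have : c (a + 0) * c (b + 0) * pairProj c (a + 0) (b + 0) (cup (cap (vertexVec c a b Z 0))) x y
        = 0 := by
      rcases a with _ | a
      · simp [hc.zero]
      rcases b with _ | b
      · simp [hc.zero]
      rw [pairProj_succ_cup, mul_eq_zero]
      right
      refine Finset.sum_eq_zero fun i _ => Finset.sum_eq_zero fun x' hx' => ?_
      rw [mul_eq_zero]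
      right
      refine Finset.sum_eq_zero fun y' hy' => ?_
      rw [mem_words] at hx' hy'
      rw [vertexVec, hZ' x' y' (by simpa using hx') (by simpa using hy'), mul_zero]
    rw [this]
    simp [capCoeff]
  | succ r ih =>
    rw [vertexVec_succ a b Z (r + 1), cap_pairProj_cup hc (biKilled_vertexVec hc hZ (r + 1)) hx hy]
    have : pairProj c (a + (r + 1)) (b + (r + 1)) (cup (cap (vertexVec c a b Z (r + 1)))) x y =
        capCoeff c (Fintype.card α) a b (r + 1) * vertexVec c a b Z (r + 1) x y := by
      rw [vertexVec_succ, ← add_assoc, ← add_assoc, ← pairProj_smul]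
      refine pairProj_congr (fun u hu v hv => ?_) x y
      obtain ⟨i, u, hu', rfl⟩ := exists_cons_of_mem hu
      obtain ⟨j, v, hv', rfl⟩ := exists_cons_of_mem hv
      have := ih hu' hv'
      rw [vertexVec_succ] at this
      simp only [cup, this, mul_ite, mul_zero]
    rw [this, capCoeff.eq_2 _ _ _ _ (r + 1)]
    ring

/-- This is ‖PF‖² = ⟨F, PF⟩ for the orthogonal projection P = p_l ⊗ p_m. -/
lemma sum_star_mul_pairProj (hc : WenzlCoeff α c) {l m : ℕ} (F : List α → List α → ℂ) :
    ∑ x ∈ words α l, ∑ y ∈ words α m, star (pairProj c l m F x y) * pairProj c l m F x y =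
      ∑ x ∈ words α l, ∑ y ∈ words α m, star (F x y) * pairProj c l m F x y := by
  set G := pairProj c l m F with hG
  have key : ∀ x' ∈ words α l, ∀ y' ∈ words α m, star (F x' y') * G x' y' =
      ∑ x ∈ words α l, ∑ y ∈ words α m,
        star (kernel c l x x' * (kernel c m y y' * F x' y')) * G x y := by
    intro x' hx' y' hy'
    have := pairProj_of_biKilled hc (biKilled_pairProj hc l m F) hx' hy'
    rw [← hG] at this
    conv_lhs => rw [← this, pairProj]
    simp only [star_mul', star_kernel hc, Finset.mul_sum]
    exact Finset.sum_congr rfl fun _ _ => Finset.sum_congr rfl fun _ _ => by ring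
  calc ∑ x ∈ words α l, ∑ y ∈ words α m, star (G x y) * G x y
      = ∑ x ∈ words α l, ∑ y ∈ words α m, ∑ x' ∈ words α l, ∑ y' ∈ words α m,
          star (kernel c l x x' * (kernel c m y y' * F x' y')) * G x y := by
        refine Finset.sum_congr rfl fun x _ => Finset.sum_congr rfl fun y _ => ?_
        have : star (G x y) = ∑ x' ∈ words α l, ∑ y' ∈ words α m,
            star (kernel c l x x' * (kernel c m y y' * F x' y')) := by
          simp only [hG, pairProj, Finset.mul_sum, star_sum]
        rw [this]
        simp only [Finset.sum_mul]
    _ = ∑ x' ∈ words α l, ∑ y' ∈ words α m, ∑ x ∈ words α l, ∑ y ∈ words α m,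
          star (kernel c l x x' * (kernel c m y y' * F x' y')) * G x y :=
        sum_comm_pairs _ _ _ _ _
    _ = _ := Finset.sum_congr rfl fun x' hx' => Finset.sum_congr rfl fun y' hy' =>
        (key x' hx' y' hy').symm

/-- Each step uses ‖P T v‖² = ⟨v, T* P T v⟩, where T* P T v is a scalar multiple of v. -/
lemma sum_star_mul_vertexVec (hc : WenzlCoeff α c) {a b : ℕ} {Z : List α → List α → ℂ}
    (hZ : BiKilled a b Z)
    (hZ' : ∀ x y : List α, x.length + 1 = a → y.length + 1 = b → cap Z x y = 0) (r : ℕ) :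
    ∑ x ∈ words α (a + r), ∑ y ∈ words α (b + r),
        star (vertexVec c a b Z r x y) * vertexVec c a b Z r x y =
      (∏ i ∈ Finset.range r, capCoeff c (Fintype.card α) a b (i + 1)) *
        ∑ x ∈ words α a, ∑ y ∈ words α b, star (Z x y) * Z x y := by
  induction r with
  | zero => simp [vertexVec]
  | succ r ih =>
    have h := sum_star_mul_pairProj hc (l := a + r + 1) (m := b + r + 1)
      (cup (vertexVec c a b Z r))
    rw [Finset.prod_range_succ, mul_right_comm, ← ih, mul_comm, Finset.mul_sum]
    refine h.trans ?_
    simp only [sum_words_succ]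
    rw [Finset.sum_comm]
    refine Finset.sum_congr rfl fun x hx => ?_
    simp only [cup]
    have : ∀ i, ∑ j, ∑ y ∈ words α (b + r), star (if i = j then vertexVec c a b Z r x y else 0) *
        pairProj c (a + r + 1) (b + r + 1) (cup (vertexVec c a b Z r)) (i :: x) (j :: y) =
        ∑ y ∈ words α (b + r), star (vertexVec c a b Z r x y) *
          vertexVec c a b Z (r + 1) (i :: x) (i :: y) := by
      intro i
      rw [Finset.sum_eq_single i]
      · simp [vertexVec]
      · intro j _ hj
        simp [Ne.symm hj]
      · simp
    simp only [this]
    rw [Finset.sum_comm, Finset.mul_sum]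
    refine Finset.sum_congr rfl fun y hy => ?_
    rw [← Finset.mul_sum]
    have := cap_vertexVec_succ hc hZ hZ' r hx hy
    rw [cap] at this
    rw [this]
    ring

/-- The intermediate projections are absorbed by the later ones, so projecting after every cup is
the same as projecting once at the end. -/
lemma vertexVec_eq_pairProj (hc : WenzlCoeff α c) {a b : ℕ} {Z : List α → List α → ℂ}
    (hZ : BiKilled a b Z) (r : ℕ) {x y : List α} (hx : x ∈ words α (a + r))
    (hy : y ∈ words α (b + r)) :
    vertexVec c a b Z r x y = pairProj c (a + r) (b + r) (cup^[r] Z) x y := by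
  induction r generalizing x y with
  | zero => exact (pairProj_of_biKilled hc hZ hx hy).symm
  | succ r ih =>
    rw [vertexVec_succ, Function.iterate_succ_apply', ← add_assoc, ← add_assoc,
      ← pairProj_cup_pairProj hc _ _ (cup^[r] Z)]
    refine pairProj_congr (fun u hu v hv => ?_) x y
    obtain ⟨i, u, hu', rfl⟩ := exists_cons_of_mem hu
    obtain ⟨j, v, hv', rfl⟩ := exists_cons_of_mem hv
    simp only [cup, ih hu' hv']

end Pairs

/-! ### Quantum numbers and the value of the θ-net -/

section QuantumNumbers

lemma qParam_spec {N : ℕ} (hN : 3 ≤ N) :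
    0 < qParam N ∧ qParam N < 1 ∧ qParam N ^ 2 + 1 = N * qParam N := by
  have hN' : (3 : ℝ) ≤ N := by exact_mod_cast hN
  have hN0 : (0 : ℝ) < N := by linarith
  have h4 : 0 < 1 - 4 / (N : ℝ) ^ 2 := by
    rw [sub_pos, div_lt_one (by positivity)]
    nlinarith
  set s := Real.sqrt (1 - 4 / (N : ℝ) ^ 2) with hs
  have hs0 : 0 < s := Real.sqrt_pos.2 h4
  have hs2 : s ^ 2 = 1 - 4 / (N : ℝ) ^ 2 := Real.sq_sqrt h4.le
  have hq : qParam N = 2 / (N * (1 + s)) := by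
    rw [qParam, ← hs]
    field_simp
  have hq0 : 0 < qParam N := by rw [hq]; positivity
  refine ⟨hq0, ?_, ?_⟩
  · rw [hq, div_lt_one (by positivity)]
    nlinarith
  · rw [hq]
    field_simp at hs2 ⊢
    nlinarith

variable {q : ℝ}

lemma qInt_eq (hq : q ≠ 0) (n : ℕ) :
    qInt q n = q * (q ^ n)⁻¹ * ((1 - (q ^ n) ^ 2) / (1 - q ^ 2)) := by
  rw [qInt, zpow_sub₀ hq, zpow_one, zpow_natCast, mul_comm 2 n, pow_mul, div_eq_mul_inv]

lemma qInt_zero (q : ℝ) : qInt q 0 = 0 := by simp [qInt]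

lemma qInt_one (hq : 0 < q) (hq1 : q < 1) : qInt q 1 = 1 := by
  have : 1 - q ^ 2 ≠ 0 := by nlinarith
  simp [qInt, this]

lemma qInt_pos (hq : 0 < q) (hq1 : q < 1) (n : ℕ) : 0 < qInt q (n + 1) := by
  have h1 : 0 < 1 - q ^ 2 := by nlinarith
  have h2 : q ^ (2 * (n + 1)) < 1 := pow_lt_one₀ hq.le hq1 (by omega)
  have h3 : 0 < 1 - q ^ (2 * (n + 1)) := by linarith
  rw [qInt]
  positivity

lemma qInt_add_two (hq : 0 < q) (hq1 : q < 1) {N : ℝ} (hN : q ^ 2 + 1 = N * q) (n : ℕ) :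
    qInt q (n + 2) = N * qInt q (n + 1) - qInt q n := by
  have h1 : 1 - q ^ 2 ≠ 0 := by nlinarith
  have hN' : N = (q ^ 2 + 1) / q := by field_simp; linarith
  rw [qInt_eq hq.ne', qInt_eq hq.ne', qInt_eq hq.ne', hN', pow_add, pow_succ]
  have hn : q ^ n ≠ 0 := by positivity
  field_simp
  ring

/-- With N = q + q⁻¹ this is a rational identity in q, q^r, q^a, q^b, valid with the four treated as
independent variables. It is the inductive step that identifies `capCoeff` with `thetaFactor`. -/
lemma qInt_cap_identity (hq : 0 < q) (hq1 : q < 1) {N : ℝ} (hN : q ^ 2 + 1 = N * q) (a b r : ℕ) :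
    N * (qInt q (a + r + 1) * qInt q (b + r + 1)) - qInt q (a + r) * qInt q (b + r + 1) -
        qInt q (b + r) * qInt q (a + r + 1) + qInt q r * qInt q (a + b + r + 1) =
      qInt q (r + 1) * qInt q (a + b + r + 2) := by
  have h1 : 1 - q ^ 2 ≠ 0 := by nlinarith
  have hN' : N = (q ^ 2 + 1) / q := by field_simp; linarith
  simp only [qInt_eq hq.ne', hN', pow_add, pow_one]
  have hr : q ^ r ≠ 0 := by positivity
  have ha : q ^ a ≠ 0 := by positivity
  have hb : q ^ b ≠ 0 := by positivity
  generalize q ^ r = R at *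
  generalize q ^ a = A at *
  generalize q ^ b = B at *
  field_simp
  ring

/-- The ratio `[n] / [n + 1]`. -/
def wenzlRatio (q : ℝ) (n : ℕ) : ℂ := ((qInt q n / qInt q (n + 1) : ℝ) : ℂ)

lemma wenzlCoeff (hq : 0 < q) (hq1 : q < 1) {N : ℕ} (hN : q ^ 2 + 1 = N * q) :
    WenzlCoeff (Fin N) (wenzlRatio q) where
  real n := Complex.conj_ofReal _
  zero := by simp [wenzlRatio, qInt_zero]
  succ n := by
    have h1 := (qInt_pos hq hq1 n).ne'
    have h2 := (qInt_pos hq hq1 (n + 1)).ne'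
    have h3 := qInt_add_two hq hq1 hN n
    simp only [wenzlRatio, Fintype.card_fin]
    norm_cast
    field_simp
    rw [h3]
    ring

/-- The factors `[r + 1] [a + b + r + 2] / ([a + r + 1] [b + r + 1])` of a `θ`-net. -/
def thetaFactor (q : ℝ) (a b r : ℕ) : ℝ :=
  qInt q (r + 1) * qInt q (a + b + r + 2) / (qInt q (a + r + 1) * qInt q (b + r + 1))

lemma capCoeff_wenzlRatio (hq : 0 < q) (hq1 : q < 1) {N : ℕ} (hN : q ^ 2 + 1 = N * q)
    (a b r : ℕ) :
    capCoeff (wenzlRatio q) N a b (r + 1) = ((thetaFactor q a b r : ℝ) : ℂ) := by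
  have key : ∀ r, wenzlRatio q (a + r) * wenzlRatio q (b + r) * capCoeff (wenzlRatio q) N a b r =
      ((qInt q r * qInt q (a + b + r + 1) / (qInt q (a + r + 1) * qInt q (b + r + 1)) : ℝ) : ℂ) →
      capCoeff (wenzlRatio q) N a b (r + 1) = ((thetaFactor q a b r : ℝ) : ℂ) := by
    intro r h
    rw [capCoeff, h, thetaFactor, ← qInt_cap_identity hq hq1 hN a b r]
    have h1 := (qInt_pos hq hq1 (a + r)).ne'
    have h2 := (qInt_pos hq hq1 (b + r)).ne'
    simp only [wenzlRatio]
    norm_cast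
    field_simp
  induction r with
  | zero => exact key 0 (by simp [capCoeff, qInt_zero])
  | succ r ih =>
    refine key (r + 1) ?_
    rw [ih, thetaFactor]
    have h1 := (qInt_pos hq hq1 (a + r)).ne'
    have h2 := (qInt_pos hq hq1 (b + r)).ne'
    simp only [wenzlRatio, ← add_assoc] at *
    norm_cast
    field_simp

lemma qFactorial_succ (q : ℝ) (n : ℕ) :
    qFactorial q (n + 1) = qFactorial q n * qInt q (n + 1) :=
  Finset.prod_range_succ _ _

lemma qFactorial_pos (hq : 0 < q) (hq1 : q < 1) (n : ℕ) : 0 < qFactorial q n :=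
  Finset.prod_pos fun i _ => qInt_pos hq hq1 i

lemma rank_add (a b r : ℕ) : rank (a + b) (a + r) (b + r) = r := by
  unfold rank
  omega

lemma theta_div_qInt (hq : 0 < q) (hq1 : q < 1) (a b r : ℕ) :
    theta q (a + b) (a + r) (b + r) / qInt q (a + b + 1) =
      ∏ i ∈ Finset.range r, thetaFactor q a b i := by
  simp only [theta, rank_add, Nat.add_sub_cancel]
  have hF := fun n => (qFactorial_pos hq hq1 n).ne'
  have hI := fun n => (qInt_pos hq hq1 n).ne'
  induction r with
  | zero =>
    have h0 : qFactorial q 0 = 1 := by simp [qFactorial]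
    have ha := hF a
    have hb := hF b
    have hab := hF (a + b)
    have hi := hI (a + b)
    simp only [add_zero, qFactorial_succ, h0, Finset.prod_range_zero]
    field_simp
  | succ r ih =>
    rw [Finset.prod_range_succ, ← ih, thetaFactor]
    simp only [← add_assoc]
    rw [qFactorial_succ q r, qFactorial_succ q (a + r), qFactorial_succ q (b + r),
      qFactorial_succ q (a + b + r + 1)]
    have h1 := hF (a + r)
    have h2 := hF (b + r)
    have h3 := hF (a + b)
    have h4 := hI (a + b)
    have h5 := hI (a + r)
    have h6 := hI (b + r)
    field_simp

lemma thetaFactor_pos (hq : 0 < q) (hq1 : q < 1) (a b r : ℕ) : 0 < thetaFactor q a b r := by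
  have h1 := qInt_pos hq hq1 r
  have h2 := qInt_pos hq hq1 (a + b + r + 1)
  have h3 := qInt_pos hq hq1 (a + r)
  have h4 := qInt_pos hq hq1 (b + r)
  rw [thetaFactor]
  positivity

/-- The powers of q in the four quantum integers combine to q⁻¹. Of the remaining factors, the two
in the denominator are at most 1, and 1 - q^{2(a+b+r+2)} is at least 1 - q^{2(r+1)}. The bound no
longer depends on a and b. -/
lemma le_thetaFactor (hq : 0 < q) (hq1 : q < 1) (a b r : ℕ) :
    q⁻¹ * (1 - q ^ (2 * (r + 1))) ^ 2 ≤ thetaFactor q a b r := by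
  have h1 : 0 < 1 - q ^ 2 := by nlinarith
  have hlt : ∀ n : ℕ, 0 < 1 - q ^ (2 * (n + 1)) := fun n =>
    sub_pos.2 (pow_lt_one₀ hq.le hq1 (by omega))
  have hle : ∀ n : ℕ, 1 - q ^ (2 * (n + 1)) ≤ 1 := fun n => by
    have : 0 < q ^ (2 * (n + 1)) := by positivity
    linarith
  have hf : thetaFactor q a b r = q⁻¹ * ((1 - q ^ (2 * (r + 1))) *
      (1 - q ^ (2 * (a + b + r + 1 + 1)))) /
        ((1 - q ^ (2 * (a + r + 1))) * (1 - q ^ (2 * (b + r + 1)))) := by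
    have ha := (hlt (a + r)).ne'
    have hb := (hlt (b + r)).ne'
    have h1' := h1.ne'
    simp only [thetaFactor, qInt, zpow_sub₀ hq.ne', zpow_one, zpow_natCast]
    have e : q ^ (a + r + 1) * q ^ (b + r + 1) * q = q ^ (r + 1) * q ^ (a + b + r + 2) := by ring
    rw [show a + b + r + 1 + 1 = a + b + r + 2 from rfl]
    have e1 : q ^ (a + r + 1) ≠ 0 := by positivity
    have e2 : q ^ (b + r + 1) ≠ 0 := by positivity
    have e3 : q ^ (r + 1) ≠ 0 := by positivity
    have e4 : q ^ (a + b + r + 2) ≠ 0 := by positivity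
    generalize 1 - q ^ (2 * (a + r + 1)) = x1 at *
    generalize 1 - q ^ (2 * (b + r + 1)) = x2 at *
    generalize 1 - q ^ (2 * (r + 1)) = x3 at *
    generalize 1 - q ^ (2 * (a + b + r + 2)) = x4 at *
    generalize q ^ (a + r + 1) = y1 at *
    generalize q ^ (b + r + 1) = y2 at *
    generalize q ^ (r + 1) = y3 at *
    generalize q ^ (a + b + r + 2) = y4 at *
    generalize 1 - q ^ 2 = z at *
    rw [div_eq_div_iff (by positivity) (by positivity)]
    field_simp
    linear_combination (x3 * x4) * e
  have hmono : 1 - q ^ (2 * (r + 1)) ≤ 1 - q ^ (2 * (a + b + r + 1 + 1)) :=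
    sub_le_sub_left (pow_le_pow_of_le_one hq.le hq1.le (by omega)) 1
  have hden : (1 - q ^ (2 * (a + r + 1))) * (1 - q ^ (2 * (b + r + 1))) ≤ 1 :=
    mul_le_one₀ (hle _) (hlt _).le (hle _)
  rw [hf, le_div_iff₀ (mul_pos (hlt _) (hlt _))]
  have hr := hlt r
  calc q⁻¹ * (1 - q ^ (2 * (r + 1))) ^ 2 *
        ((1 - q ^ (2 * (a + r + 1))) * (1 - q ^ (2 * (b + r + 1))))
      ≤ q⁻¹ * (1 - q ^ (2 * (r + 1))) ^ 2 * 1 := by gcongr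
    _ = q⁻¹ * ((1 - q ^ (2 * (r + 1))) * (1 - q ^ (2 * (r + 1)))) := by ring
    _ ≤ _ := by gcongr

lemma prod_range_le_tprod (hq : 0 < q) (hq1 : q < 1) (r : ℕ) :
    ∏ i ∈ Finset.range r, 1 / (1 - q ^ (2 * (i + 1))) ≤ ∏' s : ℕ, 1 / (1 - q ^ (2 * (s + 1))) := by
  have h1 : 0 < 1 - q ^ 2 := by nlinarith
  have hlt : ∀ n : ℕ, 0 < 1 - q ^ (2 * (n + 1)) := fun n =>
    sub_pos.2 (pow_lt_one₀ hq.le hq1 (by omega))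
  have hone : ∀ n : ℕ, 1 ≤ 1 / (1 - q ^ (2 * (n + 1))) := fun n => by
    have : 0 < q ^ (2 * (n + 1)) := by positivity
    rw [le_div_iff₀ (hlt n)]
    linarith
  -- The factors are 1 plus terms dominated by a geometric series. They are at least 1, so the
  -- partial products increase to the limit.
  have hmul : Multipliable fun s : ℕ => 1 / (1 - q ^ (2 * (s + 1))) := by
    have hg : Summable fun s : ℕ => (q ^ 2) ^ s * (q ^ 2 / (1 - q ^ 2)) :=
      (summable_geometric_of_lt_one (by positivity) (by linarith)).mul_right _
    have hs : Summable fun s : ℕ => q ^ (2 * (s + 1)) / (1 - q ^ (2 * (s + 1))) := by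
      refine Summable.of_nonneg_of_le (fun s => by have := hlt s; positivity) (fun s => ?_) hg
      have hle : 1 - q ^ 2 ≤ 1 - q ^ (2 * (s + 1)) :=
        sub_le_sub_left (pow_le_pow_of_le_one hq.le hq1.le (by omega)) 1
      calc q ^ (2 * (s + 1)) / (1 - q ^ (2 * (s + 1))) ≤ q ^ (2 * (s + 1)) / (1 - q ^ 2) := by
            gcongr
        _ = _ := by rw [← pow_mul, mul_add, pow_add]; ring
    refine (Real.multipliable_one_add_of_summable hs).congr fun s => ?_
    have := (hlt s).ne'
    field_simp
    ring
  refine ge_of_tendsto hmul.hasProd.tendsto_prod_nat ?_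
  filter_upwards [Filter.eventually_ge_atTop r] with n hn
  exact Finset.prod_mono_set_of_one_le hone (Finset.range_mono hn)

lemma log_theta_ge (hq : 0 < q) (hq1 : q < 1) (a b r : ℕ) :
    -(r : ℝ) * Real.log q - 2 * Real.log (constC q) ≤
      Real.log (∏ i ∈ Finset.range r, thetaFactor q a b i) := by
  have h1 : 0 < 1 - q ^ 2 := by nlinarith
  have hlt : ∀ n : ℕ, 0 < 1 - q ^ (2 * (n + 1)) := fun n =>
    sub_pos.2 (pow_lt_one₀ hq.le hq1 (by omega))
  set Q := ∏' s : ℕ, 1 / (1 - q ^ (2 * (s + 1))) with hQ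
  have hQ1 : 1 ≤ Q := by simpa [hQ] using prod_range_le_tprod hq hq1 0
  have hQ0 : 0 < Q := by linarith
  have hC : Real.log (constC q) = -(1 / 2) * Real.log (1 - q ^ 2) + 3 / 2 * Real.log Q := by
    rw [constC, ← hQ, Real.log_mul (by positivity) (by positivity), Real.log_rpow h1,
      Real.log_rpow hQ0]
  have hprod : q⁻¹ ^ r * (∏ i ∈ Finset.range r, (1 - q ^ (2 * (i + 1)))) ^ 2 ≤
      ∏ i ∈ Finset.range r, thetaFactor q a b i := by
    have : q⁻¹ ^ r * (∏ i ∈ Finset.range r, (1 - q ^ (2 * (i + 1)))) ^ 2 =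
        ∏ i ∈ Finset.range r, q⁻¹ * (1 - q ^ (2 * (i + 1))) ^ 2 := by
      rw [Finset.prod_mul_distrib, Finset.prod_const, Finset.card_range, Finset.prod_pow]
    rw [this]
    exact Finset.prod_le_prod (fun i _ => by positivity) fun i _ => le_thetaFactor hq hq1 a b i
  have hP : 0 < ∏ i ∈ Finset.range r, (1 - q ^ (2 * (i + 1))) := Finset.prod_pos fun i _ => hlt i
  have hPQ : -Real.log Q ≤ Real.log (∏ i ∈ Finset.range r, (1 - q ^ (2 * (i + 1)))) := by
    rw [← Real.log_inv]
    refine Real.log_le_log (by positivity) ?_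
    have := prod_range_le_tprod hq hq1 r
    rw [Finset.prod_div_distrib, Finset.prod_const_one, ← hQ] at this
    rw [inv_le_comm₀ hQ0 hP]
    simpa using this
  have hlog := Real.log_le_log (by positivity) hprod
  rw [Real.log_mul (by positivity) (by positivity), Real.log_pow, Real.log_pow, Real.log_inv]
    at hlog
  have hlogQ : 0 ≤ Real.log Q := Real.log_nonneg hQ1
  have hlogq : Real.log (1 - q ^ 2) ≤ 0 := Real.log_nonpos h1.le (by nlinarith)
  push_cast at hlog
  -- The argument gives -r log q - 2 log Q. This is stronger than required, since 2 log C(q) = 3 log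
  -- Q - log(1 - q²), where log Q ≥ 0 and log(1 - q²) ≤ 0.
  rw [hC]
  linarith

end QuantumNumbers

/-! ### Output entropy from a bound on the largest eigenvalue -/

section OutputEntropy

open scoped InnerProductSpace ComplexOrder

variable {A B C : Type*}
  [NormedAddCommGroup A] [InnerProductSpace ℂ A] [FiniteDimensional ℂ A]
  [NormedAddCommGroup B] [InnerProductSpace ℂ B] [FiniteDimensional ℂ B]
  [NormedAddCommGroup C] [InnerProductSpace ℂ C] [FiniteDimensional ℂ C]

/-- All eigenvalues λ lie in [0, K], so -λ log λ ≥ -λ log K, and the eigenvalues sum to 1. -/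
lemma neg_log_le_vonNeumannEntropy {M : C →ₗ[ℂ] C} (hM : IsState M) {K : ℝ}
    (hle : ∀ η : C, (⟪η, M η⟫_ℂ).re ≤ K * ‖η‖ ^ 2) : -Real.log K ≤ vonNeumannEntropy M := by
  have hs := hM.1.isSymmetric
  rw [vonNeumannEntropy, dif_pos hs]
  have htr : ∑ i, hs.eigenvalues rfl i = 1 := by
    have := hs.re_trace_eq_sum_eigenvalues rfl
    rw [hM.2] at this
    simpa using this.symm
  have hterm : ∀ i, hs.eigenvalues rfl i * -Real.log K ≤
      Real.negMulLog (hs.eigenvalues rfl i) := by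
    intro i
    have h0 : 0 ≤ hs.eigenvalues rfl i := hM.1.nonneg_eigenvalues rfl i
    have h1 : hs.eigenvalues rfl i ≤ K := by
      have := hle (hs.eigenvectorBasis rfl i)
      rw [hs.apply_eigenvectorBasis, inner_smul_right, inner_self_eq_norm_sq_to_K] at this
      simpa using this
    rcases h0.eq_or_lt with h | h
    · simp [← h]
    · rw [Real.negMulLog, neg_mul, mul_neg, neg_le_neg_iff]
      exact mul_le_mul_of_nonneg_left (Real.log_le_log h h1) h0
  calc -Real.log K = ∑ i, hs.eigenvalues rfl i * -Real.log K := by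
        rw [← Finset.sum_mul, htr, one_mul]
    _ ≤ _ := Finset.sum_le_sum fun i _ => hterm i

lemma re_inner_apply_eq_sum {ρ : A →ₗ[ℂ] A} (hρ : ρ.IsSymmetric) (v : A) :
    (⟪v, ρ v⟫_ℂ).re =
      ∑ i, hρ.eigenvalues rfl i * ‖⟪v, hρ.eigenvectorBasis rfl i⟫_ℂ‖ ^ 2 := by
  rw [← (hρ.eigenvectorBasis rfl).sum_inner_mul_inner, Complex.re_sum]
  refine Finset.sum_congr rfl fun i _ => ?_
  rw [← hρ, hρ.apply_eigenvectorBasis, inner_smul_left, ← inner_conj_symm (hρ.eigenvectorBasis rfl i),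
    mul_left_comm, Complex.mul_conj, Complex.normSq_eq_norm_sq]
  simp only [Complex.coe_algebraMap, Complex.conj_ofReal]
  norm_cast

/-- If the vectors `v i` satisfy a Bessel inequality with bound `K`, then
`∑ i, ⟨v i, ρ v i⟩ ≤ K Tr ρ`. -/
lemma sum_inner_apply_le {ρ : A →ₗ[ℂ] A} (hρ : IsState ρ) {ι : Type*} [Fintype ι] (v : ι → A)
    {K : ℝ} (hv : ∀ ξ, ∑ i, ‖⟪v i, ξ⟫_ℂ‖ ^ 2 ≤ K * ‖ξ‖ ^ 2) :
    ∑ i, (⟪v i, ρ (v i)⟫_ℂ).re ≤ K := by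
  have hs := hρ.1.isSymmetric
  have htr : ∑ i, hs.eigenvalues rfl i = 1 := by
    have := hs.re_trace_eq_sum_eigenvalues rfl
    rw [hρ.2] at this
    simpa using this.symm
  simp only [re_inner_apply_eq_sum hs]
  rw [Finset.sum_comm]
  calc _ ≤ ∑ j, hs.eigenvalues rfl j * K := by
        refine Finset.sum_le_sum fun j _ => ?_
        rw [← Finset.mul_sum]
        refine mul_le_mul_of_nonneg_left ?_ (hρ.1.nonneg_eigenvalues rfl j)
        simpa using hv (hs.eigenvectorBasis rfl j)
    _ = K := by rw [← Finset.sum_mul, htr, one_mul]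

lemma traceLeft_map (f : B →ₗ[ℂ] B) (g : C →ₗ[ℂ] C) :
    traceLeft (TensorProduct.map f g) = LinearMap.trace ℂ B f • g := by
  have : (homTensorHomEquiv ℂ B C B C).symm (TensorProduct.map f g) = f ⊗ₜ g := by
    rw [LinearEquiv.symm_apply_eq, homTensorHomEquiv_apply]
    rfl
  simp [traceLeft, this]

lemma traceRight_map (f : B →ₗ[ℂ] B) (g : C →ₗ[ℂ] C) :
    traceRight (TensorProduct.map f g) = LinearMap.trace ℂ C g • f := by
  have : (homTensorHomEquiv ℂ B C B C).symm (TensorProduct.map f g) = f ⊗ₜ g := by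
    rw [LinearEquiv.symm_apply_eq, homTensorHomEquiv_apply]
    rfl
  simp [traceRight, this]

/-- In finite dimension the operators f ⊗ g span all operators on the tensor product, so the partial
trace formulas need checking only on them. -/
lemma tensor_end_induction {P : (B ⊗[ℂ] C →ₗ[ℂ] B ⊗[ℂ] C) → Prop}
    (map : ∀ f g, P (TensorProduct.map f g)) (add : ∀ X Y, P X → P Y → P (X + Y)) (X) : P X := by
  obtain ⟨t, rfl⟩ := (homTensorHomEquiv ℂ B C B C).surjective X
  induction t using TensorProduct.induction_on with
  | zero =>
    have := map 0 0
    simpa using this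
  | tmul f g =>
    have := map f g
    rwa [homTensorHomEquiv_apply]
  | add x y hx hy =>
    rw [map_add]
    exact add _ _ hx hy

lemma inner_traceLeft {ι : Type*} [Fintype ι] (b : OrthonormalBasis ι ℂ B)
    (X : B ⊗[ℂ] C →ₗ[ℂ] B ⊗[ℂ] C) (η η' : C) :
    ⟪η, traceLeft X η'⟫_ℂ = ∑ i, ⟪b i ⊗ₜ[ℂ] η, X (b i ⊗ₜ[ℂ] η')⟫_ℂ := by
  induction X using tensor_end_induction with
  | map f g =>
    simp [traceLeft_map, LinearMap.trace_eq_sum_inner f b, Finset.sum_mul]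
  | add X Y hX hY => simp [hX, hY, inner_add_right, Finset.sum_add_distrib]

lemma inner_traceRight {ι : Type*} [Fintype ι] (b : OrthonormalBasis ι ℂ C)
    (X : B ⊗[ℂ] C →ₗ[ℂ] B ⊗[ℂ] C) (η η' : B) :
    ⟪η, traceRight X η'⟫_ℂ = ∑ i, ⟪η ⊗ₜ[ℂ] b i, X (η' ⊗ₜ[ℂ] b i)⟫_ℂ := by
  induction X using tensor_end_induction with
  | map f g =>
    simp [traceRight_map, LinearMap.trace_eq_sum_inner g b, Finset.mul_sum,
      mul_comm]
  | add X Y hX hY => simp [hX, hY, inner_add_right, Finset.sum_add_distrib]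

lemma trace_traceLeft (X : B ⊗[ℂ] C →ₗ[ℂ] B ⊗[ℂ] C) :
    LinearMap.trace ℂ C (traceLeft X) = LinearMap.trace ℂ (B ⊗[ℂ] C) X := by
  induction X using tensor_end_induction with
  | map f g => simp [traceLeft_map, LinearMap.trace_tensorProduct']
  | add X Y hX hY => simp [hX, hY]

lemma trace_traceRight (X : B ⊗[ℂ] C →ₗ[ℂ] B ⊗[ℂ] C) :
    LinearMap.trace ℂ B (traceRight X) = LinearMap.trace ℂ (B ⊗[ℂ] C) X := by
  induction X using tensor_end_induction with
  | map f g => simp [traceRight_map, LinearMap.trace_tensorProduct', mul_comm]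
  | add X Y hX hY => simp [hX, hY]

lemma conjMap_apply (α : A →ₗ[ℂ] B ⊗[ℂ] C) (ρ : A →ₗ[ℂ] A) :
    conjMap α ρ = α ∘ₗ ρ ∘ₗ LinearMap.adjoint α := rfl

lemma inner_conjMap (α : A →ₗ[ℂ] B ⊗[ℂ] C) (ρ : A →ₗ[ℂ] A) (x y : B ⊗[ℂ] C) :
    ⟪x, conjMap α ρ y⟫_ℂ = ⟪LinearMap.adjoint α x, ρ (LinearMap.adjoint α y)⟫_ℂ := by
  rw [conjMap_apply, LinearMap.adjoint_inner_left]
  rfl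

lemma adjoint_comp_self_of_norm {α : A →ₗ[ℂ] B ⊗[ℂ] C} (hα : ∀ ξ, ‖α ξ‖ = ‖ξ‖) :
    LinearMap.adjoint α ∘ₗ α = LinearMap.id := by
  rw [← ext_inner_map]
  intro x
  rw [LinearMap.comp_apply, LinearMap.adjoint_inner_left, inner_self_eq_norm_sq_to_K, hα,
    LinearMap.id_apply, inner_self_eq_norm_sq_to_K]

lemma trace_conjMap {α : A →ₗ[ℂ] B ⊗[ℂ] C} (hα : ∀ ξ, ‖α ξ‖ = ‖ξ‖) (ρ : A →ₗ[ℂ] A) :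
    LinearMap.trace ℂ _ (conjMap α ρ) = LinearMap.trace ℂ A ρ := by
  rw [conjMap_apply, LinearMap.trace_comp_comm', LinearMap.comp_assoc,
    adjoint_comp_self_of_norm hα, LinearMap.comp_id]

/-- An operator with the quadratic form `η ↦ ∑ i, ⟨v i η, ρ (v i η)⟩`, for a positive `ρ`, is
positive. -/
lemma isPositive_of_inner_eq_sum {V W : Type*} [NormedAddCommGroup V] [InnerProductSpace ℂ V]
    [NormedAddCommGroup W] [InnerProductSpace ℂ W] {M : W →ₗ[ℂ] W} {ρ : V →ₗ[ℂ] V}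
    (hρ : ρ.IsPositive) {ι : Type*} [Fintype ι] (v : ι → W → V) (h : ∀ η, ⟪η, M η⟫_ℂ = ∑ i, ⟪v i η, ρ (v i η)⟫_ℂ) :
    M.IsPositive := by
  rw [LinearMap.isPositive_iff_complex]
  intro η
  have h0 : 0 ≤ ⟪η, M η⟫_ℂ := by
    rw [h]
    exact Finset.sum_nonneg fun i _ => hρ.inner_nonneg_right _
  have h1 : 0 ≤ ⟪M η, η⟫_ℂ := by
    rw [← inner_conj_symm]
    exact star_nonneg_iff.2 h0
  obtain ⟨h2, h3⟩ := Complex.nonneg_iff.1 h1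
  refine ⟨?_, h2⟩
  apply Complex.ext <;> simp [← h3]

lemma exists_isState [Nontrivial A] : ∃ ρ : A →ₗ[ℂ] A, IsState ρ := by
  have hd : (Module.finrank ℂ A : ℂ) ≠ 0 := by
    exact_mod_cast Module.finrank_pos.ne'
  refine ⟨(Module.finrank ℂ A : ℂ)⁻¹ • LinearMap.id, ?_, by simp [hd]⟩
  exact LinearMap.isPositive_id.smul_of_nonneg (inv_nonneg.2 (Nat.cast_nonneg _))

/-- A common form for both complementary channels. In the application v i η = α*(b i ⊗ η), or with
the two factors exchanged, so that `hv` is a bound on contractions of α ξ against η. -/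
lemma neg_log_le_minOutputEntropy [Nontrivial A] {Φ : (A →ₗ[ℂ] A) →ₗ[ℂ] (C →ₗ[ℂ] C)}
    {K : ℝ} {ι : Type*} [Fintype ι] (v : ι → C → A)
    (htr : ∀ ρ, LinearMap.trace ℂ C (Φ ρ) = LinearMap.trace ℂ A ρ)
    (h : ∀ ρ η, ⟪η, Φ ρ η⟫_ℂ = ∑ i, ⟪v i η, ρ (v i η)⟫_ℂ)
    (hv : ∀ η ξ, ∑ i, ‖⟪v i η, ξ⟫_ℂ‖ ^ 2 ≤ K * ‖η‖ ^ 2 * ‖ξ‖ ^ 2) :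
    -Real.log K ≤ minOutputEntropy Φ := by
  -- The infimum has to be over a nonempty set for the lower bound to pass to it.
  obtain ⟨ρ₀, hρ₀⟩ := exists_isState (A := A)
  refine le_csInf ⟨_, ρ₀, hρ₀, rfl⟩ ?_
  rintro _ ⟨ρ, hρ, rfl⟩
  refine neg_log_le_vonNeumannEntropy
    ⟨isPositive_of_inner_eq_sum hρ.1 v (h ρ), (htr ρ).trans hρ.2⟩ fun η => ?_
  rw [h, Complex.re_sum]
  exact sum_inner_apply_le hρ (fun i => v i η) (hv η)

lemma neg_log_le_minOutputEntropy_channelRight [Nontrivial A] {α : A →ₗ[ℂ] B ⊗[ℂ] C}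
    (hα : ∀ ξ, ‖α ξ‖ = ‖ξ‖) {K : ℝ} {ι : Type*} [Fintype ι]
    (b : OrthonormalBasis ι ℂ B)
    (hb : ∀ η ξ, ∑ i, ‖⟪b i ⊗ₜ[ℂ] η, α ξ⟫_ℂ‖ ^ 2 ≤ K * ‖η‖ ^ 2 * ‖ξ‖ ^ 2) :
    -Real.log K ≤ minOutputEntropy (channelRight α) := by
  refine neg_log_le_minOutputEntropy
    (fun i η => LinearMap.adjoint α (b i ⊗ₜ[ℂ] η)) (fun ρ => ?_) (fun ρ η => ?_) fun η ξ => ?_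
  · rw [channelRight, LinearMap.comp_apply, trace_traceLeft, trace_conjMap hα]
  · rw [channelRight, LinearMap.comp_apply, inner_traceLeft b]
    simp only [inner_conjMap]
  · simpa only [LinearMap.adjoint_inner_left] using hb η ξ

lemma neg_log_le_minOutputEntropy_channelLeft [Nontrivial A] {α : A →ₗ[ℂ] B ⊗[ℂ] C}
    (hα : ∀ ξ, ‖α ξ‖ = ‖ξ‖) {K : ℝ} {ι : Type*} [Fintype ι]
    (b : OrthonormalBasis ι ℂ C)
    (hb : ∀ η ξ, ∑ i, ‖⟪η ⊗ₜ[ℂ] b i, α ξ⟫_ℂ‖ ^ 2 ≤ K * ‖η‖ ^ 2 * ‖ξ‖ ^ 2) :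
    -Real.log K ≤ minOutputEntropy (channelLeft α) := by
  refine neg_log_le_minOutputEntropy
    (fun i η => LinearMap.adjoint α (η ⊗ₜ[ℂ] b i)) (fun ρ => ?_) (fun ρ η => ?_) fun η ξ => ?_
  · rw [channelLeft, LinearMap.comp_apply, trace_traceRight, trace_conjMap hα]
  · rw [channelLeft, LinearMap.comp_apply, inner_traceRight b]
    simp only [inner_conjMap]
  · simpa only [LinearMap.adjoint_inner_left] using hb η ξ

end OutputEntropy

/-! ### From functions on lists to the spaces H_k -/

section Bridge

open scoped InnerProductSpace

lemma sum_word_succ {N n : ℕ} {M : Type*} [AddCommMonoid M] (f : Word N (n + 1) → M) :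
    ∑ w, f w = ∑ s : Fin N, ∑ w : Word N n, f (Fin.cons s w) := by
  rw [← Finset.sum_product', Finset.univ_product_univ]
  exact (Fintype.sum_equiv (Fin.consEquiv fun _ => Fin N) _ _ fun _ => rfl).symm

lemma idTensor_mul_cupCap_mul_idTensor {N k : ℕ} (X : Matrix (Word N (k + 1)) (Word N (k + 1)) ℂ)
    (i j : Fin N) (v w : Word N (k + 1)) :
    (idTensor X * cupCap N k * idTensor X) (Fin.cons i v) (Fin.cons j w) =
      ∑ t : Word N k, X v (Fin.cons i t) * X (Fin.cons j t) w := by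
  have h1 : ∀ (s s' : Fin N) (t : Word N k),
      (Fin.cons s (Fin.cons s' t : Word N (k + 1)) : Word N (k + 2)) 1 = s' := fun _ _ _ => rfl
  simp only [Matrix.mul_apply, sum_word_succ, idTensor, cupCap, Matrix.of_apply, Fin.cons_zero,
    Fin.tail_cons, h1, ite_and, mul_ite, ite_mul, mul_one, mul_zero, zero_mul,
    Finset.sum_ite_eq, Finset.sum_ite_eq', Finset.mem_univ, if_true, Finset.sum_const_zero,
    Finset.sum_ite_irrel]

/-- The matrix recursion starts at k = 2, whereas `kernel` applies it already at k = 1; there the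
correction vanishes since [0] = 0. -/
lemma jonesWenzl_apply (N k : ℕ) (v w : Word N k) :
    jonesWenzl N k v w = kernel (wenzlRatio (qParam N)) k (List.ofFn v) (List.ofFn w) := by
  induction k using Nat.twoStepInduction with
  | zero =>
    rw [Subsingleton.elim v w]
    simp [jonesWenzl, kernel]
  | one =>
    have : v = w ↔ v 0 = w 0 := by
      constructor
      · rintro rfl; rfl
      · intro h; funext i; rwa [Subsingleton.elim i 0]
    simp [jonesWenzl, kernel, Matrix.one_apply, this, wenzlRatio, qInt_zero]
  | more k _ ih =>
    obtain ⟨i, v, rfl⟩ : ∃ i v', v = Fin.cons i v' := ⟨v 0, Fin.tail v, (Fin.cons_self_tail v).symm⟩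
    obtain ⟨j, w, rfl⟩ : ∃ i v', w = Fin.cons i v' := ⟨w 0, Fin.tail w, (Fin.cons_self_tail w).symm⟩
    rw [jonesWenzl, Matrix.sub_apply, Matrix.smul_apply, idTensor_mul_cupCap_mul_idTensor]
    simp only [List.ofFn_cons, kernel_cons (k + 1), idTensor, Matrix.of_apply, Fin.cons_zero,
      Fin.tail_cons, ih, smul_eq_mul, Nat.add_sub_cancel, sum_words]
    rfl

/-- The coefficients of a vector in `(ℂ^N)^{⊗ k}`, as a function on lists. -/
def wordFun {N k : ℕ} (ξ : TPow N k) (x : List (Fin N)) : ℂ :=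
  ∑ w : Word N k, if List.ofFn w = x then ξ w else 0

lemma wordFun_ofFn {N k : ℕ} (ξ : TPow N k) (w : Word N k) : wordFun ξ (List.ofFn w) = ξ w := by
  simp [wordFun, List.ofFn_injective.eq_iff]

lemma sum_norm_wordFun {N k : ℕ} (ξ : TPow N k) :
    ∑ x ∈ words (Fin N) k, ‖wordFun ξ x‖ ^ 2 = ‖ξ‖ ^ 2 := by
  rw [sum_words, EuclideanSpace.norm_sq_eq]
  simp only [wordFun_ofFn]

lemma jwProj_apply (N k : ℕ) (ξ : TPow N k) (w : Word N k) :
    jwProj N k ξ w = ∑ w' : Word N k, jonesWenzl N k w w' * ξ w' := by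
  simp [jwProj, Matrix.toLpLin_apply, Matrix.mulVec, dotProduct]

lemma wordFun_jwProj {N k : ℕ} (ξ : TPow N k) {x : List (Fin N)} (hx : x ∈ words (Fin N) k) :
    wordFun (jwProj N k ξ) x =
      ∑ y ∈ words (Fin N) k, kernel (wenzlRatio (qParam N)) k x y * wordFun ξ y := by
  obtain ⟨w, rfl⟩ : ∃ w : Word N k, List.ofFn w = x := by simpa [words] using hx
  rw [wordFun_ofFn, jwProj_apply, sum_words]
  simp only [jonesWenzl_apply, wordFun_ofFn]

lemma ext_wordFun {N k : ℕ} {ξ η : TPow N k}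
    (h : ∀ x ∈ words (Fin N) k, wordFun ξ x = wordFun η x) : ξ = η := by
  ext w
  rw [← wordFun_ofFn, ← wordFun_ofFn, h _ (by simp [mem_words])]

lemma Killed.congr {α : Type*} [Fintype α] {n : ℕ} {f g : List α → ℂ} (hf : Killed n f)
    (h : ∀ x ∈ words α n, f x = g x) : Killed n g := by
  intro x y hxy
  rw [← hf x y hxy]
  exact Finset.sum_congr rfl fun s _ => (h _ (mem_words.2 (by simp; omega))).symm

lemma wenzlCoeff_qParam {N : ℕ} (hN : 3 ≤ N) : WenzlCoeff (Fin N) (wenzlRatio (qParam N)) :=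
  wenzlCoeff (qParam_spec hN).1 (qParam_spec hN).2.1 (qParam_spec hN).2.2

lemma killed_wordFun_jwProj {N k : ℕ} (hN : 3 ≤ N) (ξ : TPow N k) :
    Killed k (wordFun (jwProj N k ξ)) := by
  have h := Killed.sum (words (Fin N) k) (wordFun ξ)
    (fun y x => kernel (wenzlRatio (qParam N)) k x y)
    fun y _ => killed_kernel (wenzlCoeff_qParam hN) k y
  exact h.congr fun x hx => (wordFun_jwProj ξ hx).symm

lemma jwProj_of_killed {N k : ℕ} (hN : 3 ≤ N) {ξ : TPow N k} (h : Killed k (wordFun ξ)) :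
    jwProj N k ξ = ξ :=
  ext_wordFun fun _ hx => by
    rw [wordFun_jwProj ξ hx, sum_kernel_mul (wenzlCoeff_qParam hN) h hx]

lemma killed_wordFun_incl {N k : ℕ} (hN : 3 ≤ N) (ξ : H N k) : Killed k (wordFun (incl N k ξ)) := by
  obtain ⟨η, hη⟩ : ∃ η, jwProj N k η = incl N k ξ := ξ.2
  rw [← hη]
  exact killed_wordFun_jwProj hN η

lemma jwProj_incl {N k : ℕ} (hN : 3 ≤ N) (ξ : H N k) : jwProj N k (incl N k ξ) = incl N k ξ :=
  jwProj_of_killed hN (killed_wordFun_incl hN ξ)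

lemma jwProj_isSymmetric {N k : ℕ} (hN : 3 ≤ N) : (jwProj N k).IsSymmetric := by
  rw [jwProj, Matrix.isSymmetric_toEuclideanLin_iff]
  ext v w
  rw [Matrix.conjTranspose_apply, jonesWenzl_apply, jonesWenzl_apply,
    star_kernel (wenzlCoeff_qParam hN)]

/-- The isometric inclusion of `H_k` into `(ℂ^N)^{⊗ k}`. -/
def inclIsometry (N k : ℕ) : H N k →ₗᵢ[ℂ] TPow N k := ⟨incl N k, fun _ => rfl⟩

lemma incl_comp_proj (N k : ℕ) : incl N k ∘ₗ proj N k = jwProj N k := rfl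

lemma sum_kernel_diag {N : ℕ} (hN : 3 ≤ N) (k : ℕ) :
    ∑ x ∈ words (Fin N) k, kernel (wenzlRatio (qParam N)) k x x =
      ((qInt (qParam N) (k + 1) : ℝ) : ℂ) := by
  obtain ⟨hq, hq1, hqN⟩ := qParam_spec hN
  induction k with
  | zero => simp [words_zero, kernel, qInt_one hq hq1]
  | succ k ih =>
    rw [sum_trace_kernel (wenzlCoeff_qParam hN), ih, wenzlRatio, qInt_add_two hq hq1 hqN,
      Fintype.card_fin]
    have := (qInt_pos hq hq1 k).ne'
    norm_cast
    field_simp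

/-- The dimension is the trace of p_k. By the partial trace formula the traces satisfy the
three-term recursion of the quantum integers. -/
lemma finrank_H {N : ℕ} (hN : 3 ≤ N) (k : ℕ) :
    (Module.finrank ℂ (H N k) : ℂ) = ((qInt (qParam N) (k + 1) : ℝ) : ℂ) := by
  have hp : LinearMap.IsProj (LinearMap.range (jwProj N k)) (jwProj N k) :=
    ⟨fun x => ⟨x, rfl⟩, fun x hx => jwProj_incl hN ⟨x, hx⟩⟩
  have ht : LinearMap.trace ℂ _ (jwProj N k) = (Module.finrank ℂ (H N k) : ℂ) := hp.trace
  rw [← ht, LinearMap.trace_eq_sum_inner _ (EuclideanSpace.basisFun (Word N k) ℂ),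
    ← sum_kernel_diag hN, sum_words]
  refine Finset.sum_congr rfl fun w _ => ?_
  rw [← jonesWenzl_apply, EuclideanSpace.basisFun_apply, EuclideanSpace.inner_single_left,
    jwProj_apply]
  simp

end Bridge

/-! ### The three-vertex is a multiple of an isometry -/

section Vertex

open scoped InnerProductSpace

variable {N : ℕ}

/-- The coefficient of `e_x ⊗ e_y`. -/
def coord {l m : ℕ} (z : TPow N l ⊗[ℂ] TPow N m) (x : Word N l) (y : Word N m) : ℂ :=
  ⟪EuclideanSpace.single x (1 : ℂ) ⊗ₜ[ℂ] EuclideanSpace.single y (1 : ℂ), z⟫_ℂ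

lemma sum_norm_coord {l m : ℕ} (z : TPow N l ⊗[ℂ] TPow N m) :
    ∑ x, ∑ y, ‖coord z x y‖ ^ 2 = ‖z‖ ^ 2 := by
  rw [← ((EuclideanSpace.basisFun (Word N l) ℂ).tensorProduct
    (EuclideanSpace.basisFun (Word N m) ℂ)).sum_sq_norm_inner_right z, ← Finset.univ_product_univ,
    Finset.sum_product]
  simp [coord]

lemma coord_tmul {l m : ℕ} (a : TPow N l) (b : TPow N m) (x : Word N l) (y : Word N m) :
    coord (a ⊗ₜ[ℂ] b) x y = a x * b y := by
  simp [coord, EuclideanSpace.inner_single_left]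

lemma coord_map_jwProj {l m : ℕ} (z : TPow N l ⊗[ℂ] TPow N m) (x : Word N l) (y : Word N m) :
    coord (TensorProduct.map (jwProj N l) (jwProj N m) z) x y =
      ∑ x' : Word N l, jonesWenzl N l x x' *
        ∑ y' : Word N m, jonesWenzl N m y y' * coord z x' y' := by
  induction z using TensorProduct.induction_on with
  | zero => simp [coord]
  | tmul a b =>
    simp only [TensorProduct.map_tmul, coord_tmul, jwProj_apply, Finset.sum_mul, Finset.mul_sum]
    rw [Finset.sum_comm]
    exact Finset.sum_congr rfl fun _ _ => Finset.sum_congr rfl fun _ _ => by ring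
  | add z w hz hw =>
    simp only [coord] at hz hw ⊢
    simp only [map_add, inner_add_right, hz, hw, mul_add, Finset.sum_add_distrib]

/-- The coefficients of `(ι ⊗ T_r ⊗ ι) g`. -/
def insertFun (a r : ℕ) (g : List (Fin N) → ℂ) (x y : List (Fin N)) : ℂ :=
  if x.drop a = (y.take r).reverse then g (x.take a ++ y.drop r) else 0

lemma coord_insertCups (a b r : ℕ) (ξ : TPow N (a + b)) (x : Word N (a + r)) (y : Word N (b + r)) :
    coord (insertCups N (a + b) (a + r) (b + r) ξ) x y =
      insertFun a r (wordFun ξ) (List.ofFn x) (List.ofFn y) := by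
  classical
  rw [insertCups, Module.Basis.constr_apply_fintype, coord, inner_sum]
  simp only [inner_smul_right, inner_sum, rank_add, Insertion, Nat.add_sub_cancel]
  rw [insertFun, wordFun]
  have key : ∀ c : Word N (a + b), (∑ x' : Word N (a + r), ∑ y' : Word N (b + r),
      ⟪EuclideanSpace.single x (1 : ℂ) ⊗ₜ[ℂ] EuclideanSpace.single y (1 : ℂ),
        if List.ofFn c = (List.ofFn x').take a ++ (List.ofFn y').drop r ∧
          (List.ofFn x').drop a = ((List.ofFn y').take r).reverse then
          EuclideanSpace.single x' (1 : ℂ) ⊗ₜ[ℂ] EuclideanSpace.single y' (1 : ℂ) else 0⟫_ℂ) =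
      if List.ofFn c = (List.ofFn x).take a ++ (List.ofFn y).drop r ∧
          (List.ofFn x).drop a = ((List.ofFn y).take r).reverse then 1 else 0 := by
    intro c
    rw [Finset.sum_eq_single x, Finset.sum_eq_single y]
    · split_ifs <;> simp
    · intro y' _ hy'
      split_ifs <;> simp [EuclideanSpace.inner_single_left, Ne.symm hy']
    · simp
    · intro x' _ hx'
      refine Finset.sum_eq_zero fun y' _ => ?_
      split_ifs <;> simp [EuclideanSpace.inner_single_left, Ne.symm hx']
    · simp
  by_cases h : (List.ofFn x).drop a = ((List.ofFn y).take r).reverse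
  · simp only [key, h, and_true, if_true]
    exact Finset.sum_congr rfl fun c _ => by simp
  · simp only [key, h, and_false, if_false]
    simp

lemma map_incl_threeVertex (hN : 3 ≤ N) (k l m : ℕ) (ξ : H N k) :
    TensorProduct.map (incl N l) (incl N m) (threeVertex N k l m ξ) =
      TensorProduct.map (jwProj N l) (jwProj N m) (insertCups N k l m (incl N k ξ)) := by
  simp only [threeVertex, LinearMap.comp_apply, jwProj_incl hN]
  rw [← LinearMap.comp_apply, ← TensorProduct.map_comp, incl_comp_proj, incl_comp_proj]

lemma pairProj_reverse_left (hN : 3 ≤ N) (l m : ℕ) (F : List (Fin N) → List (Fin N) → ℂ)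
    {x : List (Fin N)} (hx : x ∈ words (Fin N) l) (y : List (Fin N)) :
    pairProj (wenzlRatio (qParam N)) l m F x.reverse y =
      pairProj (wenzlRatio (qParam N)) l m (fun x y => F x.reverse y) x y := by
  rw [pairProj, ← sum_words_reverse]
  exact Finset.sum_congr rfl fun x' hx' => by rw [kernel_reverse (wenzlCoeff_qParam hN) hx hx']

lemma insertFun_reverse {a b r : ℕ} (g : List (Fin N) → ℂ) {x y : List (Fin N)}
    (hx : x ∈ words (Fin N) (a + r)) (hy : y ∈ words (Fin N) (b + r)) :
    insertFun a r g x.reverse y = cup^[r] (fun u v => g (u.reverse ++ v)) x y := by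
  rw [mem_words] at hx hy
  rw [iterate_cup _ _ (by omega) (by omega), insertFun, List.drop_reverse, List.take_reverse,
    hx, Nat.add_sub_cancel_left]
  simp

/-- The nested cups of T_r join the end of the first word to the start of the second. Reversing the
first word moves them all to the front of both words, where `vertexVec` inserts them one at a time;
reversal commutes with p_l by `kernel_reverse`. -/
lemma norm_threeVertex (hN : 3 ≤ N) (a b r : ℕ) (ξ : H N (a + b)) :
    ‖threeVertex N (a + b) (a + r) (b + r) ξ‖ ^ 2 =
      (∏ i ∈ Finset.range r, thetaFactor (qParam N) a b i) * ‖ξ‖ ^ 2 := by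
  obtain ⟨hq, hq1, hqN⟩ := qParam_spec hN
  have hc := wenzlCoeff_qParam hN
  set c := wenzlRatio (qParam N) with hcdef
  set g := wordFun (incl N (a + b) ξ) with hg
  set Z : List (Fin N) → List (Fin N) → ℂ := fun u v => g (u.reverse ++ v) with hZdef
  have hgk : Killed (a + b) g := killed_wordFun_incl hN ξ
  have hZ : BiKilled a b Z := by
    constructor
    · intro v hv x y hxy
      rw [mem_words] at hv
      simpa [hZdef] using hgk y.reverse (x.reverse ++ v) (by simp; omega)
    · intro u hu x y hxy
      rw [mem_words] at hu
      simpa [hZdef] using hgk (u.reverse ++ x) y (by simp; omega)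
  -- The first letters of the two words of Z are adjacent in ξ, at the junction of its two halves.
  have hZ' : ∀ x y : List (Fin N), x.length + 1 = a → y.length + 1 = b → cap Z x y = 0 := by
    intro x y hx hy
    simpa [hZdef, cap] using hgk x.reverse y (by simp; omega)
  have hsum := sum_star_mul_vertexVec hc hZ hZ' r
  have hcap : ∏ i ∈ Finset.range r, capCoeff c (Fintype.card (Fin N)) a b (i + 1) =
      ((∏ i ∈ Finset.range r, thetaFactor (qParam N) a b i : ℝ) : ℂ) := by
    rw [Complex.ofReal_prod, Fintype.card_fin]
    exact Finset.prod_congr rfl fun i _ => capCoeff_wenzlRatio hq hq1 hqN a b i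
  have hnorm : ∑ x ∈ words (Fin N) a, ∑ y ∈ words (Fin N) b, ‖Z x y‖ ^ 2 = ‖ξ‖ ^ 2 := by
    rw [← (inclIsometry N (a + b)).norm_map ξ]
    change _ = ‖incl N (a + b) ξ‖ ^ 2
    rw [← sum_norm_wordFun, sum_words_add, ← sum_words_reverse]
    simp [hZdef, hg]
  have hsum' : ∑ x ∈ words (Fin N) (a + r), ∑ y ∈ words (Fin N) (b + r),
      ‖vertexVec c a b Z r x y‖ ^ 2 =
      (∏ i ∈ Finset.range r, thetaFactor (qParam N) a b i) * ‖ξ‖ ^ 2 := by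
    have hstar : ∀ z : ℂ, star z * z = ((‖z‖ ^ 2 : ℝ) : ℂ) := fun z => by
      rw [mul_comm]
      simpa using Complex.mul_conj' z
    rw [hcap] at hsum
    simp only [hstar, ← Complex.ofReal_sum, hnorm, ← Complex.ofReal_mul] at hsum
    exact_mod_cast hsum
  rw [← hsum', ← (TensorProduct.mapIsometry (inclIsometry N (a + r))
    (inclIsometry N (b + r))).norm_map]
  change ‖TensorProduct.map (incl N (a + r)) (incl N (b + r)) _‖ ^ 2 = _
  rw [map_incl_threeVertex hN, ← sum_norm_coord]
  have hcoord : ∀ (x : Word N (a + r)) (y : Word N (b + r)),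
      coord (TensorProduct.map (jwProj N (a + r)) (jwProj N (b + r))
        (insertCups N (a + b) (a + r) (b + r) (incl N (a + b) ξ))) x y =
      pairProj c (a + r) (b + r) (insertFun a r g) (List.ofFn x) (List.ofFn y) := by
    intro x y
    rw [coord_map_jwProj, pairProj, sum_words]
    simp only [sum_words, coord_insertCups, jonesWenzl_apply]
    rfl
  simp only [hcoord]
  have hwords : ∑ x : Word N (a + r), ∑ y : Word N (b + r),
      ‖pairProj c (a + r) (b + r) (insertFun a r g) (List.ofFn x) (List.ofFn y)‖ ^ 2 =
      ∑ x ∈ words (Fin N) (a + r), ∑ y ∈ words (Fin N) (b + r),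
        ‖pairProj c (a + r) (b + r) (insertFun a r g) x y‖ ^ 2 := by
    simp only [sum_words]
  rw [hwords, ← sum_words_reverse]
  refine Finset.sum_congr rfl fun x hx => Finset.sum_congr rfl fun y hy => ?_
  rw [pairProj_reverse_left hN _ _ _ hx, vertexVec_eq_pairProj hc hZ r hx hy]
  congr 2
  exact pairProj_congr (fun u hu v hv => insertFun_reverse g hu hv) _ _

end Vertex

/-! ### Contracting one leg of a three-vertex -/

section Contraction

open scoped InnerProductSpace

variable {N : ℕ}

lemma norm_sum_mul_sq_le {ι : Type*} (s : Finset ι) (f g : ι → ℂ) :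
    ‖∑ i ∈ s, f i * g i‖ ^ 2 ≤ (∑ i ∈ s, ‖f i‖ ^ 2) * ∑ i ∈ s, ‖g i‖ ^ 2 := by
  refine le_trans ?_ (Finset.sum_mul_sq_le_sq_mul_sq s (fun i => ‖f i‖) fun i => ‖g i‖)
  gcongr
  refine (norm_sum_le _ _).trans (Finset.sum_le_sum fun i _ => ?_)
  rw [norm_mul]

lemma insertFun_append {a r : ℕ} (g : List (Fin N) → ℂ) {u i j v : List (Fin N)}
    (hu : u ∈ words (Fin N) a) (hj : j ∈ words (Fin N) r) :
    insertFun a r g (u ++ i) (j ++ v) = if i = j.reverse then g (u ++ v) else 0 := by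
  rw [mem_words] at hu hj
  subst hu hj
  simp [insertFun]

/-- Splitting x = u i and y = j v, the cups force j to be the reverse of i. What remains is the
product of the matrices g(u v) and conj h(j v), summed over v, and Cauchy–Schwarz in v bounds its
Hilbert–Schmidt norm. -/
lemma sum_norm_contract_right_le (a b r : ℕ) (g h : List (Fin N) → ℂ) :
    ∑ x ∈ words (Fin N) (a + r),
        ‖∑ y ∈ words (Fin N) (b + r), star (h y) * insertFun a r g x y‖ ^ 2 ≤
      (∑ y ∈ words (Fin N) (b + r), ‖h y‖ ^ 2) * ∑ z ∈ words (Fin N) (a + b), ‖g z‖ ^ 2 := by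
  rw [add_comm b r]
  simp only [sum_words_add]
  have hin : ∀ u ∈ words (Fin N) a, ∀ i ∈ words (Fin N) r,
      ∑ j ∈ words (Fin N) r, ∑ v ∈ words (Fin N) b,
        star (h (j ++ v)) * insertFun a r g (u ++ i) (j ++ v) =
      ∑ v ∈ words (Fin N) b, star (h (i.reverse ++ v)) * g (u ++ v) := by
    intro u hu i hi
    rw [Finset.sum_eq_single i.reverse]
    · refine Finset.sum_congr rfl fun v _ => ?_
      rw [insertFun_append g hu (by simpa [mem_words] using hi)]
      simp
    · intro j hj hij
      refine Finset.sum_eq_zero fun v _ => ?_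
      rw [insertFun_append g hu hj, if_neg, mul_zero]
      rintro rfl
      simp at hij
    · intro hi'
      simp [mem_words] at hi hi'
      omega
  calc _ ≤ ∑ u ∈ words (Fin N) a, ∑ i ∈ words (Fin N) r,
        (∑ v ∈ words (Fin N) b, ‖h (i.reverse ++ v)‖ ^ 2) *
          ∑ v ∈ words (Fin N) b, ‖g (u ++ v)‖ ^ 2 := by
        refine Finset.sum_le_sum fun u hu => Finset.sum_le_sum fun i hi => ?_
        rw [hin u hu i hi]
        simpa using norm_sum_mul_sq_le (words (Fin N) b) (fun v => star (h (i.reverse ++ v)))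
          fun v => g (u ++ v)
    _ = _ := by
        simp only [← Finset.sum_mul, ← Finset.mul_sum]
        rw [sum_words_reverse r fun i => ∑ v ∈ words (Fin N) b, ‖h (i ++ v)‖ ^ 2]

lemma sum_norm_contract_left_le (a b r : ℕ) (g h : List (Fin N) → ℂ) :
    ∑ y ∈ words (Fin N) (b + r),
        ‖∑ x ∈ words (Fin N) (a + r), star (h x) * insertFun a r g x y‖ ^ 2 ≤
      (∑ x ∈ words (Fin N) (a + r), ‖h x‖ ^ 2) * ∑ z ∈ words (Fin N) (a + b), ‖g z‖ ^ 2 := by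
  rw [add_comm b r]
  simp only [sum_words_add]
  have hin : ∀ j ∈ words (Fin N) r, ∀ v : List (Fin N),
      ∑ u ∈ words (Fin N) a, ∑ i ∈ words (Fin N) r,
        star (h (u ++ i)) * insertFun a r g (u ++ i) (j ++ v) =
      ∑ u ∈ words (Fin N) a, star (h (u ++ j.reverse)) * g (u ++ v) := by
    intro j hj v
    refine Finset.sum_congr rfl fun u hu => ?_
    rw [Finset.sum_eq_single j.reverse]
    · rw [insertFun_append g hu hj, if_pos rfl]
    · intro i _ hij
      rw [insertFun_append g hu hj, if_neg hij, mul_zero]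
    · intro hj'
      simp [mem_words] at hj hj'
      omega
  calc _ ≤ ∑ j ∈ words (Fin N) r, ∑ v ∈ words (Fin N) b,
        (∑ u ∈ words (Fin N) a, ‖h (u ++ j.reverse)‖ ^ 2) *
          ∑ u ∈ words (Fin N) a, ‖g (u ++ v)‖ ^ 2 := by
        refine Finset.sum_le_sum fun j hj => Finset.sum_le_sum fun v _ => ?_
        rw [hin j hj v]
        simpa using norm_sum_mul_sq_le (words (Fin N) a) (fun u => star (h (u ++ j.reverse)))
          fun u => g (u ++ v)
    _ = _ := by
        simp only [← Finset.sum_mul, ← Finset.mul_sum]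
        rw [sum_words_reverse r fun i => ∑ u ∈ words (Fin N) a, ‖h (u ++ i)‖ ^ 2,
          Finset.sum_comm, Finset.sum_comm (s := words (Fin N) b)]

lemma inner_single_tmul {l m : ℕ} (x : Word N l) (η : TPow N m) (z : TPow N l ⊗[ℂ] TPow N m) :
    ⟪EuclideanSpace.single x (1 : ℂ) ⊗ₜ[ℂ] η, z⟫_ℂ = ∑ y, star (η y) * coord z x y := by
  induction z using TensorProduct.induction_on with
  | zero => simp [coord]
  | tmul a b =>
    simp only [coord_tmul, TensorProduct.inner_tmul,
      PiLp.inner_apply, Finset.mul_sum]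
    exact Finset.sum_congr rfl fun y _ => by simp; ring
  | add z w hz hw =>
    simp only [coord] at hz hw ⊢
    simp only [inner_add_right, hz, hw, mul_add, Finset.sum_add_distrib]

lemma inner_tmul_single {l m : ℕ} (η : TPow N l) (y : Word N m) (z : TPow N l ⊗[ℂ] TPow N m) :
    ⟪η ⊗ₜ[ℂ] EuclideanSpace.single y (1 : ℂ), z⟫_ℂ = ∑ x, star (η x) * coord z x y := by
  induction z using TensorProduct.induction_on with
  | zero => simp [coord]
  | tmul a b =>
    simp only [coord_tmul, TensorProduct.inner_tmul,
      PiLp.inner_apply, Finset.sum_mul]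
    exact Finset.sum_congr rfl fun y _ => by simp; ring
  | add z w hz hw =>
    simp only [coord] at hz hw ⊢
    simp only [inner_add_right, hz, hw, mul_add, Finset.sum_add_distrib]

section Bessel

variable {E F ι κ : Type*} [NormedAddCommGroup E] [InnerProductSpace ℂ E] [FiniteDimensional ℂ E]
  [NormedAddCommGroup F] [InnerProductSpace ℂ F] [FiniteDimensional ℂ F] [Fintype ι] [Fintype κ]

/-- By Bessel's inequality, an orthonormal basis of H_l may be replaced by the standard basis of the
ambient tensor power, in which the contraction has explicit coefficients. -/
lemma sum_norm_inner_tmul_le_right {β : ι → E} (hβ : Orthonormal ℂ β)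
    (e : OrthonormalBasis κ ℂ E) (η : F) (V : E ⊗[ℂ] F) :
    ∑ i, ‖⟪β i ⊗ₜ[ℂ] η, V⟫_ℂ‖ ^ 2 ≤ ∑ x, ‖⟪e x ⊗ₜ[ℂ] η, V⟫_ℂ‖ ^ 2 := by
  have h : ∀ x : E, ⟪x ⊗ₜ[ℂ] η, V⟫_ℂ =
      ⟪x, LinearMap.adjoint ((TensorProduct.mk ℂ E F).flip η) V⟫_ℂ := fun x => by
    rw [LinearMap.adjoint_inner_right]
    rfl
  simp only [h, e.sum_sq_norm_inner_right]
  exact hβ.sum_inner_products_le _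

lemma sum_norm_inner_tmul_le_left {β : ι → F} (hβ : Orthonormal ℂ β)
    (e : OrthonormalBasis κ ℂ F) (η : E) (V : E ⊗[ℂ] F) :
    ∑ i, ‖⟪η ⊗ₜ[ℂ] β i, V⟫_ℂ‖ ^ 2 ≤ ∑ x, ‖⟪η ⊗ₜ[ℂ] e x, V⟫_ℂ‖ ^ 2 := by
  have h : ∀ x : F, ⟪η ⊗ₜ[ℂ] x, V⟫_ℂ =
      ⟪x, LinearMap.adjoint (TensorProduct.mk ℂ E F η) V⟫_ℂ := fun x => by
    rw [LinearMap.adjoint_inner_right]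
    rfl
  simp only [h, e.sum_sq_norm_inner_right]
  exact hβ.sum_inner_products_le _

end Bessel

/-- The projections p_l and p_m are self-adjoint and fix x and y, so they drop out of the inner
product. -/
lemma inner_tmul_threeVertex (hN : 3 ≤ N) {k l m : ℕ} (x : H N l) (y : H N m) (ξ : H N k) :
    ⟪x ⊗ₜ[ℂ] y, threeVertex N k l m ξ⟫_ℂ =
      ⟪incl N l x ⊗ₜ[ℂ] incl N m y, insertCups N k l m (incl N k ξ)⟫_ℂ := by
  have hsymm : ∀ z : TPow N l ⊗[ℂ] TPow N m,
      ⟪incl N l x ⊗ₜ[ℂ] incl N m y, TensorProduct.map (jwProj N l) (jwProj N m) z⟫_ℂ =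
        ⟪incl N l x ⊗ₜ[ℂ] incl N m y, z⟫_ℂ := by
    intro z
    induction z using TensorProduct.induction_on with
    | zero => simp
    | tmul a b =>
      rw [TensorProduct.map_tmul, TensorProduct.inner_tmul, TensorProduct.inner_tmul,
        ← jwProj_isSymmetric hN, ← jwProj_isSymmetric hN, jwProj_incl hN, jwProj_incl hN]
    | add z w hz hw => rw [map_add, inner_add_right, inner_add_right, hz, hw]
  rw [← hsymm, ← map_incl_threeVertex hN]
  exact ((TensorProduct.mapIsometry (inclIsometry N l) (inclIsometry N m)).inner_map_map
    (x ⊗ₜ[ℂ] y) (threeVertex N k l m ξ)).symm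

lemma norm_sq_eq_sum_wordFun_incl {k : ℕ} (ξ : H N k) :
    ‖ξ‖ ^ 2 = ∑ x ∈ words (Fin N) k, ‖wordFun (incl N k ξ) x‖ ^ 2 := by
  rw [sum_norm_wordFun]
  rfl

lemma sum_norm_inner_threeVertex_right_le (hN : 3 ≤ N) (a b r : ℕ) {ι : Type*} [Fintype ι]
    (β : OrthonormalBasis ι ℂ (H N (a + r))) (η : H N (b + r)) (ξ : H N (a + b)) :
    ∑ i, ‖⟪β i ⊗ₜ[ℂ] η, threeVertex N (a + b) (a + r) (b + r) ξ⟫_ℂ‖ ^ 2 ≤ ‖η‖ ^ 2 * ‖ξ‖ ^ 2 := by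
  simp only [inner_tmul_threeVertex hN]
  refine (sum_norm_inner_tmul_le_right (β.orthonormal.comp_linearIsometry (inclIsometry N (a + r)))
    (EuclideanSpace.basisFun (Word N (a + r)) ℂ) _ _).trans ?_
  rw [norm_sq_eq_sum_wordFun_incl η, norm_sq_eq_sum_wordFun_incl ξ]
  refine le_trans (le_of_eq ?_) (sum_norm_contract_right_le a b r _ _)
  simp only [sum_words, EuclideanSpace.basisFun_apply, inner_single_tmul, coord_insertCups,
    wordFun_ofFn]

lemma sum_norm_inner_threeVertex_left_le (hN : 3 ≤ N) (a b r : ℕ) {ι : Type*} [Fintype ι]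
    (β : OrthonormalBasis ι ℂ (H N (b + r))) (η : H N (a + r)) (ξ : H N (a + b)) :
    ∑ i, ‖⟪η ⊗ₜ[ℂ] β i, threeVertex N (a + b) (a + r) (b + r) ξ⟫_ℂ‖ ^ 2 ≤ ‖η‖ ^ 2 * ‖ξ‖ ^ 2 := by
  simp only [inner_tmul_threeVertex hN]
  refine (sum_norm_inner_tmul_le_left (β.orthonormal.comp_linearIsometry (inclIsometry N (b + r)))
    (EuclideanSpace.basisFun (Word N (b + r)) ℂ) _ _).trans ?_
  rw [norm_sq_eq_sum_wordFun_incl η, norm_sq_eq_sum_wordFun_incl ξ]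
  refine le_trans (le_of_eq ?_) (sum_norm_contract_left_le a b r _ _)
  simp only [sum_words, EuclideanSpace.basisFun_apply, inner_tmul_single, coord_insertCups,
    wordFun_ofFn]

lemma nontrivial_H (hN : 3 ≤ N) (k : ℕ) : Nontrivial (H N k) := by
  obtain ⟨hq, hq1, _⟩ := qParam_spec hN
  have h := finrank_H hN k
  have h0 := qInt_pos hq hq1 k
  refine Module.nontrivial_of_finrank_pos (R := ℂ) (Nat.pos_of_ne_zero fun h' => ?_)
  rw [h'] at h
  norm_cast at h
  exact h0.ne h

end Contraction
end FreeOrthogonal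
end

/-! ### Normalization and assembly -/

open FreeOrthogonal in
theorem corollary4p2 (N k l m : ℕ) (hN : 3 ≤ N) (h : Admissible k l m) :
    -- the maps below are quantum channels: `α_k^{l,m}` is an isometry
    (∀ ξ : H N k, ‖alpha N k l m ξ‖ = ‖ξ‖) ∧
    -- the two descriptions of the `θ`-net agree
    LinearMap.trace ℂ (H N k)
        (LinearMap.adjoint (threeVertex N k l m) ∘ₗ threeVertex N k l m) =
      ((theta (qParam N) k l m : ℝ) : ℂ) ∧
    -- the bounds on the minimum output entropies
    Real.log (theta (qParam N) k l m / qInt (qParam N) (k + 1)) ≤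
      minOutputEntropy (channelToM N k l m) ∧
    Real.log (theta (qParam N) k l m / qInt (qParam N) (k + 1)) ≤
      minOutputEntropy (channelToL N k l m) ∧
    -(((l : ℝ) + (m : ℝ) - (k : ℝ)) / 2) * Real.log (qParam N) -
        2 * Real.log (constC (qParam N)) ≤
      Real.log (theta (qParam N) k l m / qInt (qParam N) (k + 1)) := by
  obtain ⟨r, hr, hk⟩ := h
  obtain ⟨a, rfl⟩ : ∃ a, l = a + r := ⟨l - r, by omega⟩
  obtain ⟨b, rfl⟩ : ∃ b, m = b + r := ⟨m - r, by omega⟩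
  obtain rfl : k = a + b := by omega
  obtain ⟨hq, hq1, -⟩ := qParam_spec hN
  have hnt : Nontrivial (H N (a + b)) := nontrivial_H hN (a + b)
  have hprod := theta_div_qInt hq hq1 a b r
  set t := ∏ i ∈ Finset.range r, thetaFactor (qParam N) a b i with ht
  have ht0 : 0 < t := Finset.prod_pos fun i _ => thetaFactor_pos hq hq1 a b i
  have hnorm : ∀ ξ, ‖threeVertex N (a + b) (a + r) (b + r) ξ‖ = Real.sqrt t * ‖ξ‖ := by
    intro ξ
    rw [← Real.sqrt_sq (norm_nonneg (threeVertex N (a + b) (a + r) (b + r) ξ)),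
      norm_threeVertex hN, Real.sqrt_mul ht0.le, Real.sqrt_sq (norm_nonneg ξ)]
  -- The operator norm of a homothety is its ratio only on a nonzero space, hence `hnt`.
  have hop : ‖LinearMap.toContinuousLinearMap (threeVertex N (a + b) (a + r) (b + r))‖ =
      Real.sqrt t := ContinuousLinearMap.homothety_norm _ hnorm
  have hsqrt : 0 < Real.sqrt t := Real.sqrt_pos.2 ht0
  have hα : ∀ ξ, alpha N (a + b) (a + r) (b + r) ξ =
      (((Real.sqrt t)⁻¹ : ℝ) : ℂ) • threeVertex N (a + b) (a + r) (b + r) ξ := by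
    intro ξ
    rw [alpha, hop]
    rfl
  have hiso : ∀ ξ, ‖alpha N (a + b) (a + r) (b + r) ξ‖ = ‖ξ‖ := by
    intro ξ
    rw [hα, norm_smul, hnorm, Complex.norm_real, Real.norm_of_nonneg (by positivity),
      inv_mul_cancel_left₀ hsqrt.ne']
  have hscale : ∀ (z : H N (a + r) ⊗[ℂ] H N (b + r)) ξ,
      ‖inner ℂ z (alpha N (a + b) (a + r) (b + r) ξ)‖ ^ 2 =
        t⁻¹ * ‖inner ℂ z (threeVertex N (a + b) (a + r) (b + r) ξ)‖ ^ 2 := by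
    intro z ξ
    have hsmul : inner ℂ z ((((Real.sqrt t)⁻¹ : ℝ) : ℂ) •
        threeVertex N (a + b) (a + r) (b + r) ξ) =
        (((Real.sqrt t)⁻¹ : ℝ) : ℂ) * inner ℂ z (threeVertex N (a + b) (a + r) (b + r) ξ) :=
      inner_smul_right (𝕜 := ℂ) z (threeVertex N (a + b) (a + r) (b + r) ξ)
        (((Real.sqrt t)⁻¹ : ℝ) : ℂ)
    rw [hα, hsmul, norm_mul, mul_pow, Complex.norm_real,
      Real.norm_of_nonneg (by positivity), inv_pow, Real.sq_sqrt ht0.le]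
  have hadj : LinearMap.adjoint (threeVertex N (a + b) (a + r) (b + r)) ∘ₗ
      threeVertex N (a + b) (a + r) (b + r) = (t : ℂ) • LinearMap.id := by
    rw [← ext_inner_map]
    intro ξ
    rw [LinearMap.comp_apply, LinearMap.adjoint_inner_left, inner_self_eq_norm_sq_to_K,
      LinearMap.smul_apply, inner_smul_left, LinearMap.id_apply, inner_self_eq_norm_sq_to_K]
    have := norm_threeVertex hN a b r ξ
    rw [← ht] at this
    simp only [Complex.coe_algebraMap, Complex.conj_ofReal]
    exact_mod_cast this
  have htheta : theta (qParam N) (a + b) (a + r) (b + r) = t * qInt (qParam N) (a + b + 1) := by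
    rw [← hprod, div_mul_cancel₀ _ (qInt_pos hq hq1 (a + b)).ne']
  refine ⟨hiso, ?_, ?_, ?_, ?_⟩
  · rw [hadj, map_smul, LinearMap.trace_id, finrank_H hN, htheta]
    simp
  -- The eigenvalue bound is K = t⁻¹, the contraction bound 1 divided by the squared norm t.
  · rw [hprod, ← neg_neg (Real.log t), ← Real.log_inv]
    refine neg_log_le_minOutputEntropy_channelRight hiso (stdOrthonormalBasis ℂ (H N (a + r)))
      fun η ξ => ?_
    simp only [hscale, ← Finset.mul_sum, mul_assoc]
    gcongr
    exact sum_norm_inner_threeVertex_right_le hN a b r _ η ξ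
  · rw [hprod, ← neg_neg (Real.log t), ← Real.log_inv]
    refine neg_log_le_minOutputEntropy_channelLeft hiso (stdOrthonormalBasis ℂ (H N (b + r)))
      fun η ξ => ?_
    simp only [hscale, ← Finset.mul_sum, mul_assoc]
    gcongr
    exact sum_norm_inner_threeVertex_left_le hN a b r _ η ξ
  · rw [hprod]
    have := log_theta_ge hq hq1 a b r
    rw [← ht] at this
    have e : (((a + r : ℕ) : ℝ) + ((b + r : ℕ) : ℝ) - ((a + b : ℕ) : ℝ)) / 2 = r := by
      push_cast
      ring
    rw [e]
    exact this
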